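/- **Theorem 2.1 (Error estimate for the Signorini problem).** *Setting.* Let $d\ge 1$ and let $\Omega\subset\mathbb R^d$ be a bounded connected open set with Lipschitz boundary. Let $\underline\lambda,\overline\lambda>0$ and let $\Lambda:\Omega\to M_d(\mathbb R)$ be measurable and such that, for a.e. $x\in\Omega$, $\Lambda(x)$ is symmetric with eigenvalues in $[\underline\lambda,\overline\lambda]$. Let $\Gamma_1,\Gamma_2,\Gamma_3$ be pairwise disjoint measurable sets with $\Gamma_1\cup\Gamma_2\cup\Gamma_3=\partial\Omega$, where $\Gamma_1$ has positive $(d-1)$-dimensional measure. Let $f\in L^2(\Omega)$ and $a\in L^2(\partial\Omega)$. Let $\gamma$ be the trace operator on $H^1(\Omega)$, let $H^{1/2}(\partial\Omega)=\gamma(H^1(\Omega))$ with norm $\|g\|_{H^{1/2}(\partial\Omega)}=\inf\{\|w\|_{H^1(\Omega)}: \gamma w=g\}$, and let $H^{1/2}_{\Gamma_1}(\partial\Omega)=\{g\in H^{1/2}(\partial\Omega): g=0\text{ on }\Gamma_1\}$. Let $H_{\rm div}(\Omega)=\{\psi\in L^2(\Omega)^d:\operatorname{div}\psi\in L^2(\Omega)\}$;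 the normal trace $\gamma_{\mathbf n}(\psi)\in (H^{1/2}(\partial\Omega))'$ of $\psi\in H_{\rm div}(\Omega)$ is defined by $\langle\gamma_{\mathbf n}(\psi),\gamma w\rangle=\int_\Omega\psi\cdot\nabla w\,dx+\int_\Omega w\operatorname{div}\psi\,dx$ for all $w\in H^1(\Omega)$. Let $\mathcal K=\{v\in H^1(\Omega):\gamma v=0\text{ on }\Gamma_1,\ \gamma v\le a\text{ on }\Gamma_3\}$, and let $\bar u\in\mathcal K$ be the solution of the Signorini problem, that is, $$\int_\Omega\Lambda\nabla\bar u\cdot\nabla(\bar u-v)\,dx\le\int_\Omega f(\bar u-v)\,dx\qquad\text{for all }v\in\mathcal K .$$ *Gradient discretisation.* Let $\mathcal D=(X,\Pi_{\mathcal D},\mathbb T_{\mathcal D},\nabla_{\mathcal D})$, where $X$ is a finite-dimensional real vector space and $\Pi_{\mathcal D}:X\to L^2(\Omega)$, $\mathbb T_{\mathcal D}:X\to H^{1/2}_{\Gamma_1}(\partial\Omega)$ and $\nabla_{\mathcal D}:X\to L^2(\Omega)^d$ are linear maps such that $\|\nabla_{\mathcal D}\cdot\|_{L^2(\Omega)^d}$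 is a norm on $X$. Let $\mathcal K_{\mathcal D}=\{v\in X:\mathbb T_{\mathcal D}v\le a\text{ on }\Gamma_3\}$, and define, for $v\in \mathcal K_{\mathcal D}$ and $\psi\in H_{\rm div}(\Omega)$, $$C_{\mathcal D}=\max_{v\in X\setminus\{0\}}\Big(\frac{\|\Pi_{\mathcal D}v\|_{L^2(\Omega)}}{\|\nabla_{\mathcal D}v\|_{L^2(\Omega)^d}}+\frac{\|\mathbb T_{\mathcal D}v\|_{H^{1/2}(\partial\Omega)}}{\|\nabla_{\mathcal D}v\|_{L^2(\Omega)^d}}\Big),\qquad S_{\mathcal D}(\bar u,v)=\|\Pi_{\mathcal D}v-\bar u\|_{L^2(\Omega)}+\|\nabla_{\mathcal D}v-\nabla\bar u\|_{L^2(\Omega)^d},$$ $$W_{\mathcal D}(\psi)=\sup_{v\in X\setminus\{0\}}\frac1{\|\nabla_{\mathcal D}v\|_{L^2(\Omega)^d}}\Big|\int_\Omega\big(\nabla_{\mathcal D}v\cdot\psi+\Pi_{\mathcal D}v\,\operatorname{div}\psi\big)\,dx-\langle\gamma_{\mathbf n}(\psi),\mathbb T_{\mathcal D}v\rangle\Big|$$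 (with $C_{\mathcal D}=W_{\mathcal D}(\psi)=0$ if $X=\{0\}$). *Statement.* If $\mathcal K_{\mathcal D}\neq\emptyset$, then there is a unique $u\in\mathcal K_{\mathcal D}$ such that $$\int_\Omega\Lambda\nabla_{\mathcal D}u\cdot\nabla_{\mathcal D}(u-v)\,dx\le\int_\Omega f\,\Pi_{\mathcal D}(u-v)\,dx\qquad\text{for all }v\in\mathcal K_{\mathcal D}.$$ Moreover $\Lambda\nabla\bar u\in H_{\rm div}(\Omega)$ and, for every $v_{\mathcal D}\in\mathcal K_{\mathcal D}$, with $G_{\mathcal D}(\bar u,v_{\mathcal D})=\langle\gamma_{\mathbf n}(\Lambda\nabla\bar u),\mathbb T_{\mathcal D}v_{\mathcal D}-\gamma\bar u\rangle$ and $G_{\mathcal D}^+=\max(0,G_{\mathcal D})$, $$\|\nabla_{\mathcal D}u-\nabla\bar u\|_{L^2(\Omega)^d}\le\sqrt{\tfrac2{\underline\lambda}G_{\mathcal D}(\bar u,v_{\mathcal D})^+}+\tfrac1{\underline\lambda}\big[W_{\mathcal D}(\Lambda\nabla\bar u)+(\overline\lambda+\underline\lambda)S_{\mathcal D}(\bar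 u,v_{\mathcal D})\big],$$ $$\|\Pi_{\mathcal D}u-\bar u\|_{L^2(\Omega)}\le C_{\mathcal D}\sqrt{\tfrac2{\underline\lambda}G_{\mathcal D}(\bar u,v_{\mathcal D})^+}+\tfrac1{\underline\lambda}\big[C_{\mathcal D}W_{\mathcal D}(\Lambda\nabla\bar u)+(C_{\mathcal D}\overline\lambda+\underline\lambda)S_{\mathcal D}(\bar u,v_{\mathcal D})\big].$$ -/

import Mathlib

open MeasureTheory Set Filter Topology
open scoped ContDiff RealInnerProductSpace

noncomputable section

namespace Signorini

/-- The ambient Euclidean space `ℝᵈ`. -/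
abbrev E (d : ℕ) := EuclideanSpace ℝ (Fin d)

variable {d : ℕ}

/-! ### Domains, surface measure and Lebesgue spaces -/

/-- Lipschitz boundary: near each boundary point and after a rotation (`e` is the vertical
direction), `Ω` is the strict epigraph of a Lipschitz function `h` of the horizontal component
`x - ⟪e, x⟫ e`. -/
def HasLipschitzBoundary (Ω : Set (E d)) : Prop :=
  ∀ x₀ ∈ frontier Ω, ∃ r > 0, ∃ e : E d, ‖e‖ = 1 ∧ ∃ (K : NNReal) (h : E d → ℝ),
    LipschitzWith K h ∧
      ∀ x ∈ Metric.ball x₀ r, x ∈ Ω ↔ h (x - ⟪e, x⟫ • e) < ⟪e, x⟫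

/-- The surface measure on `∂Ω`: the `(d-1)`-dimensional (normalised) Hausdorff measure
restricted to the boundary (the counting measure if `d = 1`). -/
def surfaceMeasure (Ω : Set (E d)) : Measure (E d) :=
  (Measure.euclideanHausdorffMeasure (d - 1)).restrict (frontier Ω)

/-- `L²(Ω)`. -/
abbrev L2 (Ω : Set (E d)) := Lp ℝ 2 (volume.restrict Ω)

/-- `L²(Ω)ᵈ`, with the norm `(∫_Ω |G|²)^{1/2}`. -/
abbrev L2Vec (Ω : Set (E d)) := Lp (E d) 2 (volume.restrict Ω)

/-- `L²(∂Ω)`. -/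
abbrev L2Bd (Ω : Set (E d)) := Lp ℝ 2 (surfaceMeasure Ω)

/-- Test functions: elements of `C_c^∞(Ω)`. -/
def IsTestFunction (Ω : Set (E d)) (φ : E d → ℝ) : Prop :=
  ContDiff ℝ ∞ φ ∧ HasCompactSupport φ ∧ tsupport φ ⊆ Ω

/-- The `i`-th partial derivative. -/
def partialDeriv (i : Fin d) (φ : E d → ℝ) (x : E d) : ℝ :=
  fderiv ℝ φ x (EuclideanSpace.single i 1)

lemma IsTestFunction.memLp {Ω : Set (E d)} {φ : E d → ℝ} (hφ : IsTestFunction Ω φ) :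
    MemLp φ 2 (volume.restrict Ω) :=
  hφ.1.continuous.memLp_of_hasCompactSupport hφ.2.1

lemma IsTestFunction.memLp_partialDeriv {Ω : Set (E d)} {φ : E d → ℝ}
    (hφ : IsTestFunction Ω φ) (i : Fin d) :
    MemLp (partialDeriv i φ) 2 (volume.restrict Ω) := by
  refine Continuous.memLp_of_hasCompactSupport ?_ (hφ.2.1.fderiv_apply ℝ _)
  exact (hφ.1.continuous_fderiv (by simp)).clm_apply continuous_const

lemma memLp_coord {Ω : Set (E d)} (G : L2Vec Ω) (i : Fin d) :
    MemLp (fun x => G x i) 2 (volume.restrict Ω) :=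
  (EuclideanSpace.proj i : E d →L[ℝ] ℝ).comp_memLp' (Lp.memLp G)

/-! ### The spaces `H¹(Ω)` and `H_div(Ω)` -/

/-- `G` is the weak gradient of `u` in `Ω`. -/
def IsWeakGradient (Ω : Set (E d)) (u : L2 Ω) (G : L2Vec Ω) : Prop :=
  ∀ φ, IsTestFunction Ω φ → ∀ i,
    ∫ x in Ω, u x * partialDeriv i φ x = -∫ x in Ω, G x i * φ x

/-- `δ` is the weak divergence of `ψ` in `Ω`. -/
def IsWeakDivergence (Ω : Set (E d)) (ψ : L2Vec Ω) (δ : L2 Ω) : Prop :=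
  ∀ φ, IsTestFunction Ω φ →
    ∫ x in Ω, ∑ i, ψ x i * partialDeriv i φ x = -∫ x in Ω, δ x * φ x

lemma coord_add {Ω : Set (E d)} (G H : L2Vec Ω) :
    ∀ᵐ x ∂(volume.restrict Ω), ∀ i, (G + H : L2Vec Ω) x i = G x i + H x i := by
  filter_upwards [Lp.coeFn_add G H] with x hx i
  rw [hx]; rfl

lemma coord_smul {Ω : Set (E d)} (c : ℝ) (G : L2Vec Ω) :
    ∀ᵐ x ∂(volume.restrict Ω), ∀ i, (c • G : L2Vec Ω) x i = c * G x i := by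
  filter_upwards [Lp.coeFn_smul c G] with x hx i
  rw [hx]; rfl

lemma integral_add_mul {Ω : Set (E d)} (u v : L2 Ω) {g : E d → ℝ}
    (hg : MemLp g 2 (volume.restrict Ω)) :
    ∫ x in Ω, (u + v : L2 Ω) x * g x = (∫ x in Ω, u x * g x) + ∫ x in Ω, v x * g x := by
  refine Eq.trans ?_
    (integral_add ((Lp.memLp u).integrable_mul hg) ((Lp.memLp v).integrable_mul hg))
  refine integral_congr_ae ?_
  filter_upwards [Lp.coeFn_add u v] with x hx
  simp only [hx, Pi.add_apply]; ring

lemma integral_smul_mul {Ω : Set (E d)} (c : ℝ) (u : L2 Ω) (g : E d → ℝ) :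
    ∫ x in Ω, (c • u : L2 Ω) x * g x = c * ∫ x in Ω, u x * g x := by
  rw [← integral_const_mul]
  refine integral_congr_ae ?_
  filter_upwards [Lp.coeFn_smul c u] with x hx
  simp only [hx, Pi.smul_apply, smul_eq_mul]; ring

lemma IsWeakGradient.zero (Ω : Set (E d)) : IsWeakGradient Ω 0 0 := by
  intro φ _ i
  have h1 : ∫ x in Ω, (0 : L2 Ω) x * partialDeriv i φ x = 0 := by
    simpa using integral_smul_mul 0 (0 : L2 Ω) (partialDeriv i φ)
  have h2 : ∫ x in Ω, (0 : L2Vec Ω) x i * φ x = 0 := by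
    rw [← integral_zero (E d) ℝ (μ := volume.restrict Ω)]
    refine integral_congr_ae ?_
    filter_upwards [Lp.coeFn_zero (E d) 2 (volume.restrict Ω)] with x hx
    rw [hx]
    simp
  rw [h1, h2, neg_zero]

lemma IsWeakGradient.add {Ω : Set (E d)} {u v : L2 Ω} {G H : L2Vec Ω}
    (hu : IsWeakGradient Ω u G) (hv : IsWeakGradient Ω v H) :
    IsWeakGradient Ω (u + v) (G + H) := by
  intro φ hφ i
  have h : ∫ x in Ω, (G + H : L2Vec Ω) x i * φ x
      = (∫ x in Ω, G x i * φ x) + ∫ x in Ω, H x i * φ x := by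
    refine Eq.trans ?_ (integral_add ((memLp_coord G i).integrable_mul hφ.memLp)
      ((memLp_coord H i).integrable_mul hφ.memLp))
    refine integral_congr_ae ?_
    filter_upwards [coord_add G H] with x hx
    simp only [hx]; ring
  rw [integral_add_mul u v (hφ.memLp_partialDeriv i), h, hu φ hφ i, hv φ hφ i]; ring

lemma IsWeakGradient.smul {Ω : Set (E d)} {u : L2 Ω} {G : L2Vec Ω} (c : ℝ)
    (hu : IsWeakGradient Ω u G) : IsWeakGradient Ω (c • u) (c • G) := by
  intro φ hφ i
  have h : ∫ x in Ω, (c • G : L2Vec Ω) x i * φ x = c * ∫ x in Ω, G x i * φ x := by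
    rw [← integral_const_mul]
    refine integral_congr_ae ?_
    filter_upwards [coord_smul c G] with x hx
    simp only [hx]; ring
  rw [integral_smul_mul, h, hu φ hφ i]; ring

/-- `H¹(Ω)`: a function `u ∈ L²(Ω)` together with its weak gradient `∇u ∈ L²(Ω)ᵈ` (which it
determines). The inherited norm is `(‖u‖² + ‖∇u‖²)^{1/2}`. -/
def H1 (Ω : Set (E d)) : Submodule ℝ (WithLp 2 (L2 Ω × L2Vec Ω)) where
  carrier := {p | IsWeakGradient Ω p.fst p.snd}
  zero_mem' := IsWeakGradient.zero Ω
  add_mem' hp hq := IsWeakGradient.add hp hq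
  smul_mem' c _ hp := IsWeakGradient.smul c hp

/-- The underlying function of an element of `H¹(Ω)`. -/
def H1.fn {Ω : Set (E d)} (u : H1 Ω) : L2 Ω := u.1.fst

/-- The weak gradient of an element of `H¹(Ω)`. -/
def H1.grad {Ω : Set (E d)} (u : H1 Ω) : L2Vec Ω := u.1.snd

/-- `H_div(Ω)`: a field `ψ ∈ L²(Ω)ᵈ` together with its weak divergence `div ψ ∈ L²(Ω)`
(which it determines). -/
structure Hdiv (Ω : Set (E d)) where
  /-- the vector field -/
  field : L2Vec Ω
  /-- its divergence -/
  div : L2 Ω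
  isWeakDivergence : IsWeakDivergence Ω field div

/-! ### Traces -/

/-- The graph of the restriction map `φ|_Ω ↦ φ|_∂Ω` on smooth functions. -/
def smoothTraceGraph (Ω : Set (E d)) : Submodule ℝ (H1 Ω × L2Bd Ω) where
  carrier := {p | ∃ φ : E d → ℝ, ContDiff ℝ ∞ φ ∧ HasCompactSupport φ ∧
    H1.fn p.1 =ᵐ[volume.restrict Ω] φ ∧ p.2 =ᵐ[surfaceMeasure Ω] φ}
  zero_mem' := ⟨0, contDiff_const, HasCompactSupport.zero, Lp.coeFn_zero _ _ _,
    Lp.coeFn_zero _ _ _⟩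
  add_mem' := by
    rintro p q ⟨φ, h1, h2, h3, h4⟩ ⟨φ', h1', h2', h3', h4'⟩
    exact ⟨φ + φ', h1.add h1', h2.add h2', (Lp.coeFn_add _ _).trans (h3.add h3'),
      (Lp.coeFn_add _ _).trans (h4.add h4')⟩
  smul_mem' := by
    rintro c p ⟨φ, h1, h2, h3, h4⟩
    exact ⟨c • φ, contDiff_const.smul h1, h2.smul_left (f := fun _ => c),
      (Lp.coeFn_smul _ _).trans (h3.const_smul c), (Lp.coeFn_smul _ _).trans (h4.const_smul c)⟩

/-- The graph of the trace operator `γ`: the closure in `H¹(Ω) × L²(∂Ω)` of the graph of the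
restriction of smooth functions. (If `Ω` is bounded with Lipschitz boundary, smooth functions are
dense in `H¹(Ω)` and `‖φ‖_{L²(∂Ω)} ≤ C ‖φ‖_{H¹(Ω)}`, so that this is the graph of the unique
continuous extension of the restriction to all of `H¹(Ω)`.) -/
def traceGraph (Ω : Set (E d)) : Submodule ℝ (H1 Ω × L2Bd Ω) :=
  (smoothTraceGraph Ω).topologicalClosure

/-- `γ u = g`: there are smooth functions converging to `u` in `H¹(Ω)` whose restrictions to the
boundary converge to `g` in `L²(∂Ω)`. -/
def IsTrace (Ω : Set (E d)) (u : H1 Ω) (g : L2Bd Ω) : Prop := (u, g) ∈ traceGraph Ω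

/-- `H^{1/2}(∂Ω)`: the range of the trace operator. -/
def HHalf (Ω : Set (E d)) : Submodule ℝ (L2Bd Ω) :=
  (traceGraph Ω).map (LinearMap.snd ℝ (H1 Ω) (L2Bd Ω))

/-- The norm of `H^{1/2}(∂Ω)`: `‖g‖ = inf {‖w‖_{H¹(Ω)} : γ w = g}`. -/
def hHalfNorm {Ω : Set (E d)} (g : HHalf Ω) : ℝ :=
  sInf {r | ∃ w : H1 Ω, IsTrace Ω w g ∧ r = ‖w‖}

/-- `H^{1/2}_{Γ₁}(∂Ω) = {g ∈ H^{1/2}(∂Ω) : g = 0 on Γ₁}`. -/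
def HHalfZero (Ω Γ₁ : Set (E d)) : Submodule ℝ (HHalf Ω) where
  carrier := {g | ∀ᵐ x ∂(surfaceMeasure Ω), x ∈ Γ₁ → (g : L2Bd Ω) x = 0}
  zero_mem' := by
    filter_upwards [Lp.coeFn_zero ℝ 2 (surfaceMeasure Ω)] with x hx _
    simpa using hx
  add_mem' := by
    intro g h hg hh
    filter_upwards [hg, hh, Lp.coeFn_add (g : L2Bd Ω) (h : L2Bd Ω)] with x h1 h2 h3 hx
    have : ((g + h : HHalf Ω) : L2Bd Ω) x = (g : L2Bd Ω) x + (h : L2Bd Ω) x := h3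
    rw [this, h1 hx, h2 hx, add_zero]
  smul_mem' := by
    intro c g hg
    filter_upwards [hg, Lp.coeFn_smul c (g : L2Bd Ω)] with x h1 h3 hx
    have : ((c • g : HHalf Ω) : L2Bd Ω) x = c * (g : L2Bd Ω) x := h3
    rw [this, h1 hx, mul_zero]

/-- `ℓ` is the normal trace of `ψ`, i.e. the functional on `H^{1/2}(∂Ω)` given by
`ℓ(γ w) = ∫_Ω ψ · ∇w + ∫_Ω (div ψ) w` for all `w ∈ H¹(Ω)`. -/
def IsNormalTrace {Ω : Set (E d)} (ψ : Hdiv Ω) (ℓ : Module.Dual ℝ (HHalf Ω)) : Prop :=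
  ∀ (w : H1 Ω) (g : HHalf Ω), IsTrace Ω w g →
    ℓ g = (∫ x in Ω, ⟪ψ.field x, H1.grad w x⟫) + ∫ x in Ω, ψ.div x * H1.fn w x

open Classical in
/-- The normal trace `γ_n ψ`, an element of the dual of `H^{1/2}(∂Ω)`; the duality product
`⟨γ_n ψ, g⟩` is `normalTrace ψ g`. At most one functional has the defining property, and it is
automatically continuous: `|ℓ g| ≤ (‖ψ‖² + ‖div ψ‖²)^{1/2} ‖g‖`. The value `0` is used if there is
none (never the case if `Ω` is bounded with Lipschitz boundary, by Stokes' formula). -/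
def normalTrace {Ω : Set (E d)} (ψ : Hdiv Ω) : Module.Dual ℝ (HHalf Ω) :=
  if h : ∃ ℓ, IsNormalTrace ψ ℓ then h.choose else 0

/-! ### The Signorini problem -/

/-- `Λ` is measurable on `Ω` and, for a.e. `x ∈ Ω`, `Λ(x)` is symmetric with eigenvalues in
`[lam, Lam]`. -/
def IsDiffusionTensor (Ω : Set (E d)) (Λ : E d → Matrix (Fin d) (Fin d) ℝ) (lam Lam : ℝ) : Prop :=
  (∀ i j, AEMeasurable (fun x => Λ x i j) (volume.restrict Ω)) ∧
    ∀ᵐ x ∂(volume.restrict Ω), (Λ x).IsSymm ∧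
      ∀ μ, Module.End.HasEigenvalue (Matrix.toLin' (Λ x)) μ → μ ∈ Icc lam Lam

/-- `∫_Ω Λ(x) G(x) · H(x) dx`. -/
def energy (Ω : Set (E d)) (Λ : E d → Matrix (Fin d) (Fin d) ℝ) (G H : L2Vec Ω) : ℝ :=
  ∫ x in Ω, ⟪Matrix.toEuclideanLin (Λ x) (G x), H x⟫

/-- The convex set `K = {v ∈ H¹(Ω) : γ v = 0 on Γ₁, γ v ≤ a on Γ₃}`. -/
def admissibleSet (Ω Γ₁ Γ₃ : Set (E d)) (a : L2Bd Ω) : Set (H1 Ω) :=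
  {v | ∃ g : L2Bd Ω, IsTrace Ω v g ∧ (∀ᵐ x ∂(surfaceMeasure Ω), x ∈ Γ₁ → g x = 0) ∧
    ∀ᵐ x ∂(surfaceMeasure Ω), x ∈ Γ₃ → g x ≤ a x}

/-- `u` is a solution to the weak form of the Signorini problem. -/
def IsSignoriniSolution (Ω Γ₁ Γ₃ : Set (E d)) (Λ : E d → Matrix (Fin d) (Fin d) ℝ)
    (f : L2 Ω) (a : L2Bd Ω) (u : H1 Ω) : Prop :=
  u ∈ admissibleSet Ω Γ₁ Γ₃ a ∧ ∀ v ∈ admissibleSet Ω Γ₁ Γ₃ a,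
    energy Ω Λ (H1.grad u) (H1.grad (u - v)) ≤ ∫ x in Ω, f x * H1.fn (u - v) x

/-! ### Gradient discretisations -/

/-- A gradient discretisation for the Signorini problem on the (finite dimensional) space `X` of
discrete unknowns. -/
structure GradientDiscretisation (Ω Γ₁ : Set (E d)) (X : Type*) [AddCommGroup X] [Module ℝ X]
    [FiniteDimensional ℝ X] where
  /-- the reconstructed function -/
  recFn : X →ₗ[ℝ] L2 Ω
  /-- the reconstructed trace -/
  recTrace : X →ₗ[ℝ] HHalfZero Ω Γ₁
  /-- the reconstructed gradient -/
  recGrad : X →ₗ[ℝ] L2Vec Ω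
  /-- the seminorm `v ↦ ‖∇_D v‖` is a norm -/
  recGrad_norm : ∀ v, ‖recGrad v‖ = 0 → v = 0

namespace GradientDiscretisation

variable {Ω Γ₁ : Set (E d)} {X : Type*} [AddCommGroup X] [Module ℝ X] [FiniteDimensional ℝ X]

/-- The reconstructed trace as an element of `H^{1/2}(∂Ω)`. -/
def tr (D : GradientDiscretisation Ω Γ₁ X) (v : X) : HHalf Ω := (D.recTrace v : HHalf Ω)

/-- The discrete convex set `K_D = {v ∈ X : T_D v ≤ a on Γ₃}`. -/
def admissibleSet (D : GradientDiscretisation Ω Γ₁ X) (Γ₃ : Set (E d)) (a : L2Bd Ω) : Set X :=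
  {v | ∀ᵐ x ∂(surfaceMeasure Ω), x ∈ Γ₃ → (D.tr v : L2Bd Ω) x ≤ a x}

/-- `u` is a solution to the gradient scheme. -/
def IsSolution (D : GradientDiscretisation Ω Γ₁ X) (Γ₃ : Set (E d))
    (Λ : E d → Matrix (Fin d) (Fin d) ℝ) (f : L2 Ω) (a : L2Bd Ω) (u : X) : Prop :=
  u ∈ D.admissibleSet Γ₃ a ∧ ∀ v ∈ D.admissibleSet Γ₃ a,
    energy Ω Λ (D.recGrad u) (D.recGrad (u - v)) ≤ ∫ x in Ω, f x * D.recFn (u - v) x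

/-- The coercivity constant `C_D`. -/
def coercivity (D : GradientDiscretisation Ω Γ₁ X) : ℝ :=
  sSup {r | ∃ v : X, v ≠ 0 ∧
    r = ‖D.recFn v‖ / ‖D.recGrad v‖ + hHalfNorm (D.tr v) / ‖D.recGrad v‖}

/-- The consistency indicator `S_D(φ, v)`. -/
def consistency (D : GradientDiscretisation Ω Γ₁ X) (φ : H1 Ω) (v : X) : ℝ :=
  ‖D.recFn v - H1.fn φ‖ + ‖D.recGrad v - H1.grad φ‖

/-- The limit-conformity indicator `W_D(ψ)`. -/
def limitConformity (D : GradientDiscretisation Ω Γ₁ X) (ψ : Hdiv Ω) : ℝ :=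
  sSup {r | ∃ v : X, v ≠ 0 ∧ r = 1 / ‖D.recGrad v‖ *
    |(∫ x in Ω, (⟪D.recGrad v x, ψ.field x⟫ + D.recFn v x * ψ.div x))
      - normalTrace ψ (D.tr v)|}

end GradientDiscretisation

end Signorini

end

/-! The scheme is a variational inequality on a finite-dimensional space. Its unique solution is the
projection, in the inner product `∫ Λ∇_D u · ∇_D v`, of the Riesz representative of the source onto
a closed convex set (`existsUnique_variationalInequality`).

For the error, perturbing `ubar` by test functions of either sign gives `div (Λ∇ubar) = -f`, so `ψ =
Λ∇ubar` lies in `H_div`. The discrete trace of `u` vanishes on Γ₁ and is at most `a` on Γ₃, so any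
lifting of it to `H¹` competes with `ubar`. This gives `⟨γ_n ψ, T_D u - γ ubar⟩ ≥ 0`
(`normalTrace_sub_nonneg`). Added to the scheme tested with `v` and to the bound defining `W_D` at
`v - u`, it yields `lam x² ≤ (W_D + Lam S_D) x + G_D` for `x = ‖∇_D(v - u)‖`. Solving for `x` and
two triangle inequalities conclude.

The analytic core is the existence of the normal trace: `∫ ψ·∇w + ∫ w div ψ` must vanish whenever
`w` has zero trace (`greenPairing_eq_zero_of_isTrace_zero`). For smooth `φ` and a cut-off `χ` equal
to 1 outside a boundary layer of width ε, the pairing with `χφ` is zero. The remainder is at most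
the L² mass of `ψ` and `div ψ` in the layer times `‖φ‖_{H¹} + (4/ε)‖φ‖_{L²(layer)}`. Integrating
along vertical lines in Lipschitz charts gives `‖φ‖_{L²(layer)} ≤ C(√ε ‖φ‖_{L²(∂Ω)} + ε ‖∇φ‖)`, so
the factor `4/ε` does no harm to the gradient term. Smooth approximation at fixed ε removes the
boundary term when the trace is zero, and letting ε → 0 removes the mass. -/

noncomputable section

namespace Signorini

open scoped ENNReal NNReal

/-! ### Coordinates above a Lipschitz graph. -/

section Chart

variable {V : Type*} [NormedAddCommGroup V] [InnerProductSpace ℝ V]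

open Module Measure

lemma inner_orthogonal_add_smul {e : V} (he : ‖e‖ = 1) (y : (ℝ ∙ e)ᗮ) (t : ℝ) :
    ⟪e, (y : V) + t • e⟫ = t := by
  have h1 : ⟪e, (y : V)⟫ = 0 :=
    (Submodule.mem_orthogonal_singleton_iff_inner_right (u := e)).1 y.2
  rw [inner_add_right, h1, inner_smul_right, real_inner_self_eq_norm_sq, he]
  ring

/-- The coordinates above the graph of `h` in the direction `e`. -/
def graphMap (e : V) (h : V → ℝ) (p : (ℝ ∙ e)ᗮ × ℝ) : V := (p.1 : V) + (h p.1 + p.2) • e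

lemma continuous_graphMap (e : V) {h : V → ℝ} (hh : Continuous h) : Continuous (graphMap e h) := by
  unfold graphMap
  fun_prop

lemma inner_graphMap {e : V} (he : ‖e‖ = 1) (h : V → ℝ) (p : (ℝ ∙ e)ᗮ × ℝ) :
    ⟪e, graphMap e h p⟫ = h p.1 + p.2 := inner_orthogonal_add_smul he _ _

lemma graphMap_sub_inner {e : V} (he : ‖e‖ = 1) (h : V → ℝ) (p : (ℝ ∙ e)ᗮ × ℝ) :
    graphMap e h p - ⟪e, graphMap e h p⟫ • e = p.1 := by
  rw [inner_graphMap he, graphMap, add_sub_cancel_right]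

variable [FiniteDimensional ℝ V] [MeasurableSpace V] [BorelSpace V]

/-- Orthogonal coordinates along a line preserve the volume. -/
lemma measurePreserving_orthogonal_add_smul {e : V} (he : ‖e‖ = 1) :
    MeasurePreserving (fun p : (ℝ ∙ e)ᗮ × ℝ => (p.1 : V) + p.2 • e)
      (volume.prod volume) volume := by
  have h1 := (Submodule.measurePreserving_measurableEquivProd (ℝ ∙ e) (0 : V)).symm
  rw [InnerProductSpace.euclideanHausdorffMeasure_eq_volume] at h1
  have h2 := (LinearIsometryEquiv.toSpanUnitSingleton e he).measurePreserving
  have h3 := h2.prod (MeasurePreserving.id (volume : Measure (ℝ ∙ e)ᗮ))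
  have h4 := measurePreserving_swap (μ := (volume : Measure (ℝ ∙ e)ᗮ)) (ν := (volume : Measure ℝ))
  have h5 := h1.comp (h3.comp h4)
  have h6 : (fun p : (ℝ ∙ e)ᗮ × ℝ => (p.1 : V) + p.2 • e)
      = ((ℝ ∙ e).measurableEquivProd (0 : V)).symm ∘
        (Prod.map (LinearIsometryEquiv.toSpanUnitSingleton e he) id ∘ Prod.swap) := by
    funext p
    simp [add_comm]
  rw [h6]
  exact h5

/-- The map is an orthogonal change of coordinates after a shear. The shear translates each vertical
line, so Fubini suffices and `h` need not be differentiable. -/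
lemma measurePreserving_graphMap {e : V} (he : ‖e‖ = 1) {h : V → ℝ} (hh : Continuous h) :
    MeasurePreserving (graphMap e h) (volume.prod volume) volume := by
  have h1 : MeasurePreserving (fun p : (ℝ ∙ e)ᗮ × ℝ => (p.1, h p.1 + p.2))
      (volume.prod volume) (volume.prod volume) :=
    (MeasurePreserving.id (volume : Measure (ℝ ∙ e)ᗮ)).skew_product
      (g := fun (y : (ℝ ∙ e)ᗮ) (t : ℝ) => h (y : V) + t) (by fun_prop)
      (Eventually.of_forall fun y => (measurePreserving_add_left volume (h (y : V))).map_eq)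
  exact (measurePreserving_orthogonal_add_smul he).comp h1

/-- Orthogonal projections are 1-Lipschitz, and the normalising constant depends on `n` only, so it
is the same on both sides. -/
lemma euclideanHausdorffMeasure_image_orthogonalProjection_le (s : Submodule ℝ V) (n : ℕ)
    (A : Set V) :
    (euclideanHausdorffMeasure n : Measure s) (s.orthogonalProjectionOnto '' A)
      ≤ euclideanHausdorffMeasure n A := by
  rw [euclideanHausdorffMeasure_def, euclideanHausdorffMeasure_def, Measure.smul_apply,
    Measure.smul_apply]
  gcongr
  simpa using s.lipschitzWith_orthogonalProjectionOnto.hausdorffMeasure_image_le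
    (Nat.cast_nonneg n) A

/-- The surface measure of a graph dominates the volume of its projection. -/
lemma lintegral_graph_le {e : V} {h : V → ℝ} (hh : Continuous h)
    {n : ℕ} (hn : finrank ℝ (ℝ ∙ e)ᗮ = n) {g : V → ℝ≥0∞} {Y : Set (ℝ ∙ e)ᗮ} {S : Set V}
    (hS : ∀ y ∈ Y, graphMap e h (y, 0) ∈ S) :
    ∫⁻ y in Y, g (graphMap e h (y, 0)) ≤ ∫⁻ x in S, g x ∂(euclideanHausdorffMeasure n) := by
  set σ : (ℝ ∙ e)ᗮ → V := fun y => graphMap e h (y, 0) with hσ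
  have hσc : Continuous σ := (continuous_graphMap e hh).comp (by fun_prop)
  have hinv : Function.LeftInverse (ℝ ∙ e)ᗮ.orthogonalProjectionOnto σ := by
    intro y
    simp only [hσ, graphMap, map_add, Submodule.orthogonalProjectionOnto_mem_subspace_eq_self,
      map_smul,
      Submodule.orthogonalProjectionOnto_orthogonalComplement_singleton_eq_zero, smul_zero, add_zero]
  have hemb : MeasurableEmbedding σ :=
    (hinv.isClosedEmbedding (ContinuousLinearMap.continuous _) hσc).measurableEmbedding
  -- Projecting the graph back to the hyperplane does not increase measure. Only this inequality is
  -- needed, so no area formula enters.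
  have hle : Measure.map σ volume ≤ euclideanHausdorffMeasure n := by
    refine Measure.le_iff.2 fun A hA => ?_
    rw [hemb.map_apply]
    refine le_trans ?_ (euclideanHausdorffMeasure_image_orthogonalProjection_le (ℝ ∙ e)ᗮ n A)
    rw [← hn, InnerProductSpace.euclideanHausdorffMeasure_eq_volume]
    exact measure_mono fun y hy => ⟨σ y, hy, hinv y⟩
  calc ∫⁻ y in Y, g (σ y) ≤ ∫⁻ y in σ ⁻¹' S, g (σ y) := lintegral_mono_set hS
    _ = ∫⁻ x in S, g x ∂(Measure.map σ volume) := by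
        rw [hemb.restrict_map, hemb.lintegral_map]
    _ ≤ _ := lintegral_mono' (Measure.restrict_mono_measure hle _) le_rfl

end Chart

/-- One-dimensional trace estimate. -/
lemma enorm_sq_le_of_contDiff {u : ℝ → ℝ} (hu : ContDiff ℝ 1 u) {t M : ℝ} (ht : 0 < t)
    (htM : t ≤ M) :
    ‖u t‖ₑ ^ 2 ≤ 2 * ‖u 0‖ₑ ^ 2 + 2 * ENNReal.ofReal M * ∫⁻ s in Ioo 0 M, ‖deriv u s‖ₑ ^ 2 := by
  have hc : Continuous (deriv u) := hu.continuous_deriv le_rfl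
  have h1 : ‖u t - u 0‖ₑ ≤ ∫⁻ s in Ioo 0 M, ‖deriv u s‖ₑ := by
    rw [← intervalIntegral.integral_deriv_eq_sub (fun x _ => (hu.differentiable (by simp)) x)
      (hc.intervalIntegrable _ _), intervalIntegral.integral_of_le ht.le]
    refine (enorm_integral_le_lintegral_enorm _).trans ?_
    rw [setLIntegral_congr Ioo_ae_eq_Ioc.symm]
    exact lintegral_mono_set (Ioo_subset_Ioo le_rfl htM)
  have h2 : (∫⁻ s in Ioo 0 M, ‖deriv u s‖ₑ) ^ 2
      ≤ ENNReal.ofReal M * ∫⁻ s in Ioo 0 M, ‖deriv u s‖ₑ ^ 2 := by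
    have := ENNReal.lintegral_mul_le_Lp_mul_Lq (volume.restrict (Ioo 0 M))
      (Real.HolderConjugate.two_two) (f := fun _ => 1) (g := fun s => ‖deriv u s‖ₑ)
      aemeasurable_const (by fun_prop)
    simp only [Pi.mul_apply, one_mul, ENNReal.one_rpow, lintegral_const,
      Measure.restrict_apply_univ, Real.volume_Ioo, sub_zero] at this
    calc _ ≤ _ := pow_le_pow_left₀ zero_le this 2
      _ = _ := by
        rw [mul_pow, ← ENNReal.rpow_natCast, ← ENNReal.rpow_natCast, ← ENNReal.rpow_mul,
          ← ENNReal.rpow_mul]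
        norm_num
  calc ‖u t‖ₑ ^ 2 = ‖u 0 + (u t - u 0)‖ₑ ^ 2 := by rw [add_sub_cancel]
    _ ≤ (‖u 0‖ₑ + ‖u t - u 0‖ₑ) ^ 2 := pow_le_pow_left₀ zero_le (enorm_add_le _ _) 2
    _ ≤ 2 * (‖u 0‖ₑ ^ 2 + ‖u t - u 0‖ₑ ^ 2) := by
        have := ENNReal.rpow_add_le_mul_rpow_add_rpow ‖u 0‖ₑ ‖u t - u 0‖ₑ (p := 2) (by norm_num)
        norm_num at this
        exact_mod_cast this
    _ ≤ 2 * (‖u 0‖ₑ ^ 2 + ENNReal.ofReal M * ∫⁻ s in Ioo 0 M, ‖deriv u s‖ₑ ^ 2) := by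
        gcongr
        exact (pow_le_pow_left₀ zero_le h1 2).trans h2
    _ = _ := by ring

/-! ### L² estimate in a thin layer along the boundary. -/

section Layer

open Module

variable {d : ℕ}

lemma norm_sub_inner_smul_le {e : E d} (he : ‖e‖ = 1) (x : E d) : ‖x - ⟪e, x⟫ • e‖ ≤ ‖x‖ := by
  have h : ‖x - ⟪e, x⟫ • e‖ ^ 2 = ‖x‖ ^ 2 - ⟪e, x⟫ ^ 2 := by
    rw [norm_sub_sq_real, inner_smul_right, norm_smul, he, real_inner_comm, Real.norm_eq_abs,
      mul_one, sq_abs]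
    ring
  exact le_of_sq_le_sq (by rw [h]; nlinarith [sq_nonneg ⟪e, x⟫]) (norm_nonneg _)

/-- In a chart, boundary points lie on the graph. -/
lemma frontier_iff_of_epigraph {Ω : Set (E d)} (hΩ : IsOpen Ω) {x₀ e : E d} {r : ℝ} (he : ‖e‖ = 1)
    {h : E d → ℝ} (hh : Continuous h)
    (hepi : ∀ x ∈ Metric.ball x₀ r, x ∈ Ω ↔ h (x - ⟪e, x⟫ • e) < ⟪e, x⟫)
    {x : E d} (hx : x ∈ Metric.ball x₀ r) : x ∈ frontier Ω ↔ h (x - ⟪e, x⟫ • e) = ⟪e, x⟫ := by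
  rw [hΩ.frontier_eq]
  constructor
  · rintro ⟨hxc, hxn⟩
    refine le_antisymm ?_ (not_lt.1 fun hlt => hxn ((hepi x hx).2 hlt))
    by_contra! hlt
    have hU : IsOpen (Metric.ball x₀ r ∩ {z | ⟪e, z⟫ < h (z - ⟪e, z⟫ • e)}) :=
      Metric.isOpen_ball.inter (isOpen_lt (by fun_prop) (by fun_prop))
    obtain ⟨z, ⟨hz1, hz2⟩, hz3⟩ := mem_closure_iff.1 hxc _ hU ⟨hx, hlt⟩
    exact absurd ((hepi z hz1).1 hz3) (not_lt.2 (le_of_lt hz2))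
  · intro heq
    refine ⟨?_, fun hxΩ => absurd ((hepi x hx).1 hxΩ) (by rw [heq]; exact lt_irrefl _)⟩
    have ht : Tendsto (fun t : ℝ => x + t • e) (𝓝[>] 0) (𝓝 x) := by
      have : ContinuousAt (fun t : ℝ => x + t • e) 0 := by fun_prop
      have h2 := this.tendsto
      simp only [zero_smul, add_zero] at h2
      exact h2.mono_left nhdsWithin_le_nhds
    refine mem_closure_of_tendsto ht ?_
    filter_upwards [ht (Metric.isOpen_ball.mem_nhds hx), self_mem_nhdsWithin] with t htb ht0
    have h1 : ⟪e, x + t • e⟫ = ⟪e, x⟫ + t := by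
      rw [inner_add_right, inner_smul_right, real_inner_self_eq_norm_sq, he]; ring
    refine (hepi _ htb).2 ?_
    have h2 : x + t • e - ⟪e, x + t • e⟫ • e = x - ⟪e, x⟫ • e := by
      rw [h1, add_smul]; abel
    rw [h2, h1, heq]
    exact lt_add_of_pos_right _ ht0

/-- The trace estimate near the boundary, localised to the part `S` of the boundary: the constant is
uniform with respect to the width of the layer. -/
def LayerEstimate (Ω S : Set (E d)) : Prop :=
  ∃ C : ℝ≥0, ∃ ε₀ > 0, ∀ ε, 0 < ε → ε < ε₀ → ∀ φ : E d → ℝ, ContDiff ℝ 1 φ →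
    ∫⁻ x in Ω ∩ Metric.thickening ε S, ‖φ x‖ₑ ^ 2 ≤
      C * (ENNReal.ofReal ε * ∫⁻ x, ‖φ x‖ₑ ^ 2 ∂(surfaceMeasure Ω)
        + ENNReal.ofReal ε ^ 2 * ∫⁻ x in Ω, ‖fderiv ℝ φ x‖ₑ ^ 2)

/-- The one-dimensional estimate is applied on each vertical segment of height `M = (1 + K)ε` and
integrated. One factor `M` is the height of the layer, the other comes from Cauchy–Schwarz. Since `M
< r/4`, segments meeting the layer stay inside the chart. -/
lemma layerEstimate_chart (hd : 1 ≤ d) {Ω : Set (E d)} (hΩ : IsOpen Ω) {x₀ e : E d} {r : ℝ}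
    (hr : 0 < r) (he : ‖e‖ = 1) {K : ℝ≥0} {h : E d → ℝ} (hh : LipschitzWith K h)
    (hepi : ∀ x ∈ Metric.ball x₀ r, x ∈ Ω ↔ h (x - ⟪e, x⟫ • e) < ⟪e, x⟫) :
    LayerEstimate Ω (frontier Ω ∩ Metric.ball x₀ (r / 4)) := by
  have hhc := hh.continuous
  refine ⟨2 * (1 + K) ^ 2, r / (4 * (1 + K)), by positivity, fun ε hε hε₀ φ hφ => ?_⟩
  set M : ℝ := (1 + K) * ε with hM
  have hM0 : 0 < M := by positivity
  have hMr : M < r / 4 := by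
    rw [lt_div_iff₀ (by positivity)] at hε₀
    rw [hM]; linarith
  have hεM : ε ≤ M := by
    rw [hM]; nlinarith [K.coe_nonneg]
  set A := Ω ∩ Metric.thickening ε (frontier Ω ∩ Metric.ball x₀ (r / 4)) with hA
  set T := graphMap e h with hT
  have hTm := measurePreserving_graphMap he hhc
  have hTc := continuous_graphMap e hhc
  have hAm : MeasurableSet A := hΩ.measurableSet.inter Metric.isOpen_thickening.measurableSet
  have hφc := hφ.continuous
  have hφ' : Continuous (fderiv ℝ φ) := hφ.continuous_fderiv (by simp)
  have hTΩ : ∀ p : (ℝ ∙ e)ᗮ × ℝ, T p ∈ Metric.ball x₀ r → (T p ∈ Ω ↔ 0 < p.2) := by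
    intro p hp
    rw [hepi _ hp, hT, graphMap_sub_inner he, inner_graphMap he]
    simp
  have hTdist : ∀ (y : (ℝ ∙ e)ᗮ) (s t : ℝ), dist (T (y, s)) (T (y, t)) = |s - t| := by
    intro y s t
    rw [dist_eq_norm, hT, graphMap, graphMap, add_sub_add_left_eq_sub, ← sub_smul, norm_smul, he,
      mul_one, add_sub_add_left_eq_sub, Real.norm_eq_abs]
  -- points of the layer
  have key : ∀ p : (ℝ ∙ e)ᗮ × ℝ, T p ∈ A → 0 < p.2 ∧ p.2 < M ∧
      ∀ s, 0 ≤ s → s ≤ M → T (p.1, s) ∈ Metric.ball x₀ r := by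
    intro p hp
    obtain ⟨hpΩ, hpt⟩ := hp
    obtain ⟨z, ⟨hzf, hzb⟩, hz⟩ := Metric.mem_thickening_iff.1 hpt
    have hpx : dist (T p) x₀ < r / 4 + ε := by
      have := dist_triangle (T p) z x₀
      rw [Metric.mem_ball] at hzb
      linarith
    have hpb : T p ∈ Metric.ball x₀ r := by
      rw [Metric.mem_ball]; linarith
    have hzb' : z ∈ Metric.ball x₀ r := Metric.ball_subset_ball (by linarith) hzb
    have hp0 := (hTΩ p hpb).1 hpΩ
    have hzeq := (frontier_iff_of_epigraph hΩ he hhc hepi hzb').1 hzf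
    -- Because `z` lies on the graph, the height `p.2` is the difference of vertical coordinates of
    -- `T p` and `z` plus a difference of values of `h`. These are at most `‖T p - z‖` and `K ‖T p -
    -- z‖`.
    have hpM : p.2 < M := by
      have e1 : h p.1 + p.2 = ⟪e, T p⟫ := (inner_graphMap he h p).symm
      have e2 : (p.1 : E d) = T p - ⟪e, T p⟫ • e := (graphMap_sub_inner he h p).symm
      have e3 : |h (z - ⟪e, z⟫ • e) - h p.1| ≤ K * ‖T p - z‖ := by
        rw [e2, ← Real.dist_eq]
        refine (hh.dist_le_mul _ _).trans ?_
        gcongr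
        rw [dist_comm, dist_eq_norm]
        have : T p - ⟪e, T p⟫ • e - (z - ⟪e, z⟫ • e) = (T p - z) - ⟪e, T p - z⟫ • e := by
          rw [inner_sub_right, sub_smul]; abel
        rw [this]
        exact norm_sub_inner_smul_le he _
      have e4 : ⟪e, T p⟫ - ⟪e, z⟫ ≤ ‖T p - z‖ := by
        rw [← inner_sub_right]
        simpa [he] using real_inner_le_norm e (T p - z)
      rw [dist_eq_norm] at hz
      have e5 := (abs_le.1 e3).2
      have e6 : K * ‖T p - z‖ ≤ K * ε := by gcongr
      rw [hM]
      nlinarith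
    refine ⟨hp0, hpM, fun s hs0 hsM => ?_⟩
    have h1 := hTdist p.1 s p.2
    have h2 : |s - p.2| ≤ M := abs_le.2 ⟨by linarith, by linarith⟩
    have h3 := dist_triangle (T (p.1, s)) (T p) x₀
    rw [Metric.mem_ball]
    have h4 : dist (T (p.1, s)) (T p) ≤ M := by
      rw [← Prod.mk.eta (p := p)]; exact h1.trans_le h2
    linarith
  set Y : Set (ℝ ∙ e)ᗮ := {y | T (y, 0) ∈ Metric.ball x₀ r} with hY
  have hYm : MeasurableSet Y :=
    (Metric.isOpen_ball.preimage (hTc.comp (by fun_prop : Continuous fun y => (y, (0:ℝ))))).measurableSet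
  -- Extension by zero outside `Ω` allows integration over entire vertical lines, which Fubini
  -- reassembles into the integral over `Ω`.
  set g : E d → ℝ≥0∞ := Ω.indicator (fun x => ‖fderiv ℝ φ x‖ₑ ^ 2) with hg
  have hgm : Measurable g := by
    refine Measurable.indicator ?_ hΩ.measurableSet
    fun_prop
  -- This bound does not depend on the height, so integrating it over the layer only costs a factor
  -- `M`.
  set R : (ℝ ∙ e)ᗮ → ℝ≥0∞ := fun y => 2 * Y.indicator (fun y => ‖φ (T (y, 0))‖ₑ ^ 2) y
    + 2 * ENNReal.ofReal M * ∫⁻ s, g (T (y, s)) with hR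
  have hbound : ∀ p : (ℝ ∙ e)ᗮ × ℝ, T p ∈ A → ‖φ (T p)‖ₑ ^ 2 ≤ R p.1 := by
    intro p hp
    obtain ⟨h0, h1, h2⟩ := key p hp
    have hcurve : ∀ s, HasDerivAt (fun s => T (p.1, s)) e s := by
      intro s
      simp only [hT, graphMap]
      have := (((hasDerivAt_id s).const_add (h p.1)).smul_const e).const_add (p.1 : E d)
      simpa using this
    have hderiv : ∀ s, deriv (fun s => φ (T (p.1, s))) s = fderiv ℝ φ (T (p.1, s)) e := fun s =>
      (((hφ.differentiable (by simp) _).hasFDerivAt).comp_hasDerivAt s (hcurve s)).deriv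
    have hu : ContDiff ℝ 1 (fun s => φ (T (p.1, s))) := by
      refine hφ.comp ?_
      simp only [hT, graphMap]
      fun_prop
    refine (enorm_sq_le_of_contDiff hu h0 h1.le).trans ?_
    simp only [hR]
    have hpY : p.1 ∈ Y := h2 0 le_rfl hM0.le
    rw [indicator_of_mem hpY]
    refine add_le_add le_rfl (mul_le_mul_right ?_ _)
    refine (setLIntegral_mono' measurableSet_Ioo (g := fun s => g (T (p.1, s))) ?_).trans
      (setLIntegral_le_lintegral _ _)
    intro s hs
    have hsΩ : T (p.1, s) ∈ Ω := (hTΩ _ (h2 s hs.1.le hs.2.le)).2 hs.1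
    simp only [hg]
    rw [indicator_of_mem hsΩ, hderiv]
    gcongr
    have := (fderiv ℝ φ (T (p.1, s))).le_opENorm e
    rwa [← ofReal_norm e, he, ENNReal.ofReal_one, mul_one] at this
  have hRm : Measurable R := by
    refine Measurable.add (measurable_const.mul (Measurable.indicator ?_ hYm))
      (measurable_const.mul ?_)
    · exact (hφc.comp (hTc.comp (by fun_prop : Continuous fun y => (y, (0:ℝ))))).measurable.enorm.pow_const 2
    · exact Measurable.lintegral_prod_right' (f := fun p => g (T p)) (hgm.comp hTc.measurable)
  have hfin : finrank ℝ (ℝ ∙ e)ᗮ = d - 1 := by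
    have h1 := (ℝ ∙ e).finrank_add_finrank_orthogonal
    have h2 : finrank ℝ (ℝ ∙ e) = 1 := finrank_span_singleton (by
      rintro rfl; simp at he)
    rw [h2, finrank_euclideanSpace_fin] at h1
    omega
  calc ∫⁻ x in A, ‖φ x‖ₑ ^ 2 = ∫⁻ p in T ⁻¹' A, ‖φ (T p)‖ₑ ^ 2 ∂(volume.prod volume) :=
        (hTm.setLIntegral_comp_preimage hAm (by fun_prop)).symm
    _ ≤ ∫⁻ p in univ ×ˢ Ioo 0 M, R p.1 ∂(volume.prod volume) := by
        refine (setLIntegral_mono' (hAm.preimage hTc.measurable) hbound).trans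
          (lintegral_mono_set fun p hp => ?_)
        exact ⟨mem_univ _, (key p hp).1, (key p hp).2.1⟩
    _ = ENNReal.ofReal M * ∫⁻ y, R y := by
        rw [← Measure.prod_restrict, Measure.restrict_univ,
          lintegral_prod (fun p => R p.1) (hRm.comp measurable_fst).aemeasurable]
        simp only [lintegral_const, Measure.restrict_apply_univ, Real.volume_Ioo, sub_zero]
        rw [lintegral_mul_const _ hRm, mul_comm]
    _ = ENNReal.ofReal M * (2 * (∫⁻ y in Y, ‖φ (T (y, 0))‖ₑ ^ 2)
          + 2 * ENNReal.ofReal M * ∫⁻ x in Ω, ‖fderiv ℝ φ x‖ₑ ^ 2) := by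
        congr 1
        simp only [hR]
        rw [lintegral_add_right, lintegral_const_mul', lintegral_indicator hYm,
          lintegral_const_mul']
        · congr 2
          rw [← lintegral_indicator hΩ.measurableSet, ← hTm.lintegral_comp hgm,
            lintegral_prod (fun p => g (graphMap e h p)) (hgm.comp hTc.measurable).aemeasurable]
        · finiteness
        · finiteness
        · exact measurable_const.mul
            (Measurable.lintegral_prod_right' (f := fun p => g (T p)) (hgm.comp hTc.measurable))
    _ ≤ ENNReal.ofReal M * (2 * (∫⁻ x, ‖φ x‖ₑ ^ 2 ∂(surfaceMeasure Ω))
          + 2 * ENNReal.ofReal M * ∫⁻ x in Ω, ‖fderiv ℝ φ x‖ₑ ^ 2) := by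
        gcongr
        refine lintegral_graph_le hhc hfin (g := fun x => ‖φ x‖ₑ ^ 2) (fun y hy => ?_)
        rw [frontier_iff_of_epigraph hΩ he hhc hepi hy, hT, graphMap_sub_inner he,
          inner_graphMap he, add_zero]
    _ ≤ _ := by
        have hofM : ENNReal.ofReal M = (1 + K) * ENNReal.ofReal ε := by
          rw [hM, ENNReal.ofReal_mul (by positivity), ENNReal.ofReal_add zero_le_one K.coe_nonneg]
          simp
        rw [hofM]
        push_cast
        generalize ENNReal.ofReal ε = a
        generalize ∫⁻ x, ‖φ x‖ₑ ^ 2 ∂(surfaceMeasure Ω) = b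
        generalize ∫⁻ x in Ω, ‖fderiv ℝ φ x‖ₑ ^ 2 = c
        have h1 : (1 + K : ℝ≥0∞) ≤ (1 + K) ^ 2 := le_self_pow₀ (by simp) (by norm_num)
        calc (1 + K : ℝ≥0∞) * a * (2 * b + 2 * ((1 + K) * a) * c)
            = 2 * (1 + K) * (a * b) + 2 * (1 + K) ^ 2 * (a ^ 2 * c) := by ring
          _ ≤ 2 * (1 + K) ^ 2 * (a * b) + 2 * (1 + K) ^ 2 * (a ^ 2 * c) := by gcongr
          _ = _ := by ring

/-- The trace estimate near the boundary of a bounded Lipschitz domain. -/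
lemma layerEstimate_frontier (hd : 1 ≤ d) {Ω : Set (E d)} (hΩ : IsOpen Ω)
    (hΩb : Bornology.IsBounded Ω) (hΩL : HasLipschitzBoundary Ω) :
    LayerEstimate Ω (frontier Ω) := by
  have hcomp : IsCompact (frontier Ω) :=
    Metric.isCompact_of_isClosed_isBounded isClosed_frontier
      (hΩb.closure.subset frontier_subset_closure)
  have mono : ∀ ⦃s t : Set (E d)⦄, s ⊆ t → LayerEstimate Ω t → LayerEstimate Ω s := by
    rintro s t hst ⟨C, ε₀, h0, h⟩
    exact ⟨C, ε₀, h0, fun ε h1 h2 φ hφ => (lintegral_mono_set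
      (inter_subset_inter_right _ (Metric.thickening_subset_of_subset ε hst))).trans (h ε h1 h2 φ hφ)⟩
  refine hcomp.induction_on (p := LayerEstimate Ω) ?_ mono ?_ ?_
  · exact ⟨0, 1, one_pos, fun ε _ _ φ _ => by simp⟩
  · rintro s t ⟨C, ε₀, h0, h⟩ ⟨C', ε₀', h0', h'⟩
    refine ⟨C + C', min ε₀ ε₀', lt_min h0 h0', fun ε h1 h2 φ hφ => ?_⟩
    rw [Metric.thickening_union, inter_union_distrib_left]
    refine (lintegral_union_le _ _ _).trans ?_
    push_cast
    rw [add_mul]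
    exact add_le_add (h ε h1 (h2.trans_le (min_le_left _ _)) φ hφ)
      (h' ε h1 (h2.trans_le (min_le_right _ _)) φ hφ)
  · intro x hx
    obtain ⟨r, hr, e, he, K, h, hh, hepi⟩ := hΩL x hx
    refine ⟨frontier Ω ∩ Metric.ball x (r / 4), ?_, layerEstimate_chart hd hΩ hr he hh hepi⟩
    exact inter_mem_nhdsWithin _ (Metric.ball_mem_nhds x (by positivity))

end Layer

/-! ### Cut-off functions with gradient of order 1/ε. -/

section Cutoff

open ContinuousLinearMap

variable {d : ℕ}

/-- The convolution averages translates of `g` with nonnegative weights of total mass one, so the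
Lipschitz constant is preserved. -/
lemma lipschitzWith_normed_convolution (ρ : ContDiffBump (0 : E d)) {K : ℝ≥0} {g : E d → ℝ}
    (hg : LipschitzWith K g) :
    LipschitzWith K (convolution (ρ.normed volume) g (lsmul ℝ ℝ) volume) := by
  have hint : ∀ x, Integrable (fun t => ρ.normed volume t * g (x - t)) volume := fun x =>
    (ρ.continuous_normed.mul (hg.continuous.comp (continuous_const.sub continuous_id))).integrable_of_hasCompactSupport
      ρ.hasCompactSupport_normed.mul_right
  refine LipschitzWith.of_dist_le_mul fun x y => ?_
  simp only [convolution_def, lsmul_apply, smul_eq_mul]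
  rw [Real.dist_eq, ← integral_sub (hint x) (hint y), ← Real.norm_eq_abs]
  calc _ ≤ ∫ t, ρ.normed volume t * (K * dist x y) := by
        refine norm_integral_le_of_norm_le (ρ.integrable_normed.mul_const _)
          (Eventually.of_forall fun t => ?_)
        rw [← mul_sub, norm_mul, Real.norm_of_nonneg (ρ.nonneg_normed t), ← dist_eq_norm]
        refine mul_le_mul_of_nonneg_left ?_ (ρ.nonneg_normed t)
        refine (hg.dist_le_mul _ _).trans_eq ?_
        simp
    _ = _ := by rw [integral_mul_const, ρ.integral_normed, one_mul]

/-- Smooth cut-off functions equal to `1` away from the boundary. -/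
lemma exists_smooth_cutoff {Ω : Set (E d)} (hΩu : Ω ≠ univ) {ε : ℝ} (hε : 0 < ε) :
    ∃ χ : E d → ℝ, ContDiff ℝ ∞ χ ∧ tsupport χ ⊆ Ω ∧ (∀ x, χ x ∈ Icc (0 : ℝ) 1) ∧
      (∀ x ∈ Ω, x ∉ Metric.thickening ε (frontier Ω) → χ x = 1) ∧
      ∀ x, ‖fderiv ℝ χ x‖ ≤ 4 / ε := by
  set δ : E d → ℝ := fun x => Metric.infDist x Ωᶜ with hδ
  have hδl : LipschitzWith 1 δ := Metric.lipschitz_infDist_pt _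
  set K : ℝ≥0 := ⟨4 / ε, by positivity⟩ with hK
  have hKε : (K : ℝ) = 4 / ε := rfl
  -- The profile climbs from 0 at distance ε/2 to 1 at distance 3ε/4, hence the slope 4/ε.
  -- Mollifying at radius ε/4 then leaves 0 below distance ε/4 and 1 from distance ε on.
  have hgl : LipschitzWith K (fun x => max 0 (min 1 (4 / ε * δ x - 2))) := by
    have h1 : LipschitzWith K (fun x => 4 / ε * δ x - 2) := by
      refine LipschitzWith.of_dist_le_mul fun x y => ?_
      rw [Real.dist_eq, sub_sub_sub_cancel_right, ← mul_sub, abs_mul, abs_of_pos (by positivity),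
        ← Real.dist_eq, hKε]
      gcongr
      simpa using hδl.dist_le_mul x y
    exact (h1.const_min 1).const_max 0
  set g : E d → ℝ := fun x => max 0 (min 1 (4 / ε * δ x - 2)) with hg
  have hg01 : ∀ x, g x ∈ Icc (0 : ℝ) 1 := fun x =>
    ⟨le_max_left _ _, max_le zero_le_one (min_le_left _ _)⟩
  have hg0 : ∀ x, δ x ≤ ε / 2 → g x = 0 := fun x hx => by
    refine max_eq_left ((min_le_right _ _).trans ?_)
    have : 4 / ε * δ x ≤ 4 / ε * (ε / 2) := by gcongr
    have h2 : 4 / ε * (ε / 2) = 2 := by field_simp; norm_num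
    linarith
  have hg1 : ∀ x, 3 * ε / 4 ≤ δ x → g x = 1 := fun x hx => by
    have : 4 / ε * (3 * ε / 4) ≤ 4 / ε * δ x := by gcongr
    have h2 : 4 / ε * (3 * ε / 4) = 3 := by field_simp
    simp only [hg]
    rw [min_eq_left (by linarith), max_eq_right zero_le_one]
  let ρ : ContDiffBump (0 : E d) := ⟨ε / 8, ε / 4, by positivity, by linarith⟩
  set χ := convolution (ρ.normed volume) g (lsmul ℝ ℝ) volume with hχ
  have hδb : ∀ x y, y ∈ Metric.ball x ρ.rOut → |δ y - δ x| < ε / 4 := fun x y hy => by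
    have := hδl.dist_le_mul y x
    rw [NNReal.coe_one, one_mul, Real.dist_eq] at this
    exact this.trans_lt hy
  have hχ0 : ∀ x, δ x < ε / 4 → χ x = 0 := by
    intro x hx
    have h0 := hg0 x (by linarith)
    rw [← h0]
    refine ρ.normed_convolution_eq_right fun y hy => ?_
    rw [h0]
    exact hg0 y (by have := (abs_lt.1 (hδb x y hy)).2; linarith)
  have hχ1 : ∀ x, ε ≤ δ x → χ x = 1 := by
    intro x hx
    have h1 := hg1 x (by linarith)
    rw [← h1]
    refine ρ.normed_convolution_eq_right fun y hy => ?_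
    rw [h1]
    exact hg1 y (by have := (abs_lt.1 (hδb x y hy)).1; linarith)
  refine ⟨χ, ?_, ?_, ?_, ?_, ?_⟩
  · exact ρ.hasCompactSupport_normed.contDiff_convolution_left _ ρ.contDiff_normed
      hgl.continuous.locallyIntegrable
  · have hsub : tsupport χ ⊆ {x | ε / 4 ≤ δ x} := by
      refine closure_minimal (fun x hx => ?_) (isClosed_le continuous_const hδl.continuous)
      by_contra hlt
      exact hx (hχ0 x (not_le.1 hlt))
    intro x hx
    by_contra hxΩ
    have h1 : δ x = 0 := Metric.infDist_zero_of_mem hxΩ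
    have h2 : ε / 4 ≤ δ x := hsub hx
    linarith
  · intro x
    have hint : Integrable (fun t => ρ.normed volume t * g (x - t)) volume :=
      (ρ.continuous_normed.mul (hgl.continuous.comp (continuous_const.sub continuous_id))).integrable_of_hasCompactSupport
        ρ.hasCompactSupport_normed.mul_right
    simp only [hχ, convolution_def, lsmul_apply, smul_eq_mul]
    constructor
    · exact integral_nonneg fun t => mul_nonneg (ρ.nonneg_normed t) (hg01 _).1
    · rw [← ρ.integral_normed (μ := volume)]
      exact integral_mono hint ρ.integrable_normed
        fun t => mul_le_of_le_one_right (ρ.nonneg_normed t) (hg01 _).2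
  · intro x hx hxt
    refine hχ1 x (not_lt.1 fun hlt => hxt ?_)
    -- For a point of `Ω` the distance to the complement is attained on the frontier.
    obtain ⟨y, hy, hxy⟩ := exists_mem_frontier_infDist_compl_eq_dist hx hΩu
    exact Metric.mem_thickening_iff.2 ⟨y, hy, hxy ▸ hlt⟩
  · intro x
    exact norm_fderiv_le_of_lipschitz ℝ (lipschitzWith_normed_convolution ρ hgl)

end Cutoff

/-! ### Weak gradients of smooth functions. -/

section WeakGradient

variable {d : ℕ} {Ω : Set (E d)}

lemma gradient_apply (φ : E d → ℝ) (x : E d) (i : Fin d) :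
    gradient φ x i = partialDeriv i φ x := by
  rw [partialDeriv, ← toDual_gradient, InnerProductSpace.toDual_apply_apply,
    EuclideanSpace.inner_single_right]
  simp

lemma norm_gradient (φ : E d → ℝ) (x : E d) : ‖gradient φ x‖ = ‖fderiv ℝ φ x‖ := by
  rw [← toDual_gradient, LinearIsometryEquiv.norm_map]

lemma inner_gradient (φ : E d → ℝ) (x y : E d) :
    ⟪y, gradient φ x⟫ = ∑ i, y i * partialDeriv i φ x := by
  rw [PiLp.inner_apply]
  refine Finset.sum_congr rfl fun i _ => ?_
  rw [gradient_apply, real_inner_comm]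
  rfl

lemma continuous_gradient {φ : E d → ℝ} (hφ : ContDiff ℝ ∞ φ) : Continuous (gradient φ) :=
  (LinearIsometryEquiv.continuous _).comp (hφ.continuous_fderiv (by simp))

lemma hasCompactSupport_gradient {φ : E d → ℝ} (hφ : HasCompactSupport φ) :
    HasCompactSupport (gradient φ) :=
  (hφ.fderiv ℝ).comp_left (map_zero _)

lemma memLp_of_contDiff {φ : E d → ℝ} (hφ : ContDiff ℝ ∞ φ) (hφc : HasCompactSupport φ) :
    MemLp φ 2 (volume.restrict Ω) :=
  hφ.continuous.memLp_of_hasCompactSupport hφc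

lemma memLp_gradient {φ : E d → ℝ} (hφ : ContDiff ℝ ∞ φ) (hφc : HasCompactSupport φ) :
    MemLp (gradient φ) 2 (volume.restrict Ω) :=
  (continuous_gradient hφ).memLp_of_hasCompactSupport (hasCompactSupport_gradient hφc)

/-- The weak gradient is unique. -/
lemma IsWeakGradient.unique (hΩ : IsOpen Ω) {u : L2 Ω} {G H : L2Vec Ω}
    (hG : IsWeakGradient Ω u G) (hH : IsWeakGradient Ω u H) : G = H := by
  have hcoord : ∀ i, ∀ᵐ x ∂(volume.restrict Ω), G x i = H x i := by
    intro i
    have hGi := memLp_coord G i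
    have hHi := memLp_coord H i
    rw [ae_restrict_iff' hΩ.measurableSet]
    have hloc : LocallyIntegrableOn (fun x => G x i - H x i) Ω volume := by
      rw [locallyIntegrableOn_iff hΩ.isLocallyClosed]
      intro k hkΩ hk
      have : IsFiniteMeasure ((volume.restrict Ω).restrict k) :=
        ⟨by rw [Measure.restrict_apply_univ]; exact (Measure.restrict_apply_le _ _).trans_lt hk.measure_lt_top⟩
      have := ((hGi.sub hHi).restrict k).integrable (by norm_num)
      rwa [Measure.restrict_restrict_of_subset hkΩ] at this
    have := hΩ.ae_eq_zero_of_integral_contDiff_smul_eq_zero hloc (fun φ h1 h2 h3 => by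
      have hφ : IsTestFunction Ω φ := ⟨h1, h2, h3⟩
      have hz : ∫ x, φ x • (G x i - H x i) = ∫ x in Ω, φ x • (G x i - H x i) := by
        rw [setIntegral_eq_integral_of_forall_compl_eq_zero]
        intro x hx
        rw [image_eq_zero_of_notMem_tsupport (fun h => hx (h3 h)), zero_smul]
      rw [hz]
      have e1 := hG φ hφ i
      have e2 := hH φ hφ i
      have e3 : ∫ x in Ω, φ x • (G x i - H x i) = (∫ x in Ω, G x i * φ x) - ∫ x in Ω, H x i * φ x := by
        refine Eq.trans (integral_congr_ae (Eventually.of_forall fun x => ?_))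
          (integral_sub (hGi.integrable_mul hφ.memLp) (hHi.integrable_mul hφ.memLp))
        simp only [smul_eq_mul]; ring
      rw [e3]; linarith)
    filter_upwards [this] with x hx hxΩ
    linarith [hx hxΩ]
  refine Lp.ext ?_
  filter_upwards [ae_all_iff.2 hcoord] with x hx
  ext i
  exact hx i

/-- The classical gradient of a smooth function is its weak gradient. -/
lemma isWeakGradient_toLp_gradient {φ : E d → ℝ} (hφ : ContDiff ℝ ∞ φ)
    (hφc : HasCompactSupport φ) :
    IsWeakGradient Ω (MemLp.toLp φ (memLp_of_contDiff hφ hφc))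
      (MemLp.toLp (gradient φ) (memLp_gradient hφ hφc)) := by
  intro η hη i
  -- The test function `η` is supported in `Ω`, so both integrals extend to the whole space, where
  -- integration by parts has no boundary term.
  have h1 : ∫ x in Ω, MemLp.toLp φ (memLp_of_contDiff (Ω := Ω) hφ hφc) x * partialDeriv i η x
      = ∫ x, φ x * partialDeriv i η x := by
    refine Eq.trans (integral_congr_ae ?_)
      (setIntegral_eq_integral_of_forall_compl_eq_zero (s := Ω) ?_)
    · filter_upwards [MemLp.coeFn_toLp (memLp_of_contDiff (Ω := Ω) hφ hφc)] with x hx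
      rw [hx]
    · intro x hx
      have : x ∉ tsupport (fderiv ℝ η) := fun h => hx (hη.2.2 (tsupport_fderiv_subset ℝ h))
      rw [partialDeriv, image_eq_zero_of_notMem_tsupport this]
      simp
  have h2 : ∫ x in Ω, MemLp.toLp (gradient φ) (memLp_gradient (Ω := Ω) hφ hφc) x i * η x
      = ∫ x, partialDeriv i φ x * η x := by
    refine Eq.trans (integral_congr_ae ?_)
      (setIntegral_eq_integral_of_forall_compl_eq_zero (s := Ω) ?_)
    · filter_upwards [MemLp.coeFn_toLp (memLp_gradient (Ω := Ω) hφ hφc)] with x hx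
      rw [hx, gradient_apply]
    · intro x hx
      rw [image_eq_zero_of_notMem_tsupport (fun h => hx (hη.2.2 h)), mul_zero]
  rw [h1, h2]
  have hcφ : Continuous (fun x => fderiv ℝ φ x (EuclideanSpace.single i 1)) :=
    (hφ.continuous_fderiv (by simp)).clm_apply continuous_const
  have hcη : Continuous (fun x => fderiv ℝ η x (EuclideanSpace.single i 1)) :=
    (hη.1.continuous_fderiv (by simp)).clm_apply continuous_const
  refine integral_mul_fderiv_eq_neg_fderiv_mul_of_integrable ?_ ?_ ?_
    (fun x _ => hφ.differentiable (by simp) x) (fun x _ => hη.1.differentiable (by simp) x)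
  · exact (hcφ.mul hη.1.continuous).integrable_of_hasCompactSupport hη.2.1.mul_left
  · exact (hφ.continuous.mul hcη).integrable_of_hasCompactSupport hφc.mul_right
  · exact (hφ.continuous.mul hη.1.continuous).integrable_of_hasCompactSupport hφc.mul_right

/-- The element of `H¹(Ω)` given by a smooth compactly supported function. -/
def smoothH1 (Ω : Set (E d)) {φ : E d → ℝ} (hφ : ContDiff ℝ ∞ φ)
    (hφc : HasCompactSupport φ) : H1 Ω :=
  ⟨WithLp.toLp 2 (MemLp.toLp φ (memLp_of_contDiff hφ hφc),
    MemLp.toLp (gradient φ) (memLp_gradient hφ hφc)), isWeakGradient_toLp_gradient hφ hφc⟩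

lemma fn_smoothH1 {φ : E d → ℝ} (hφ : ContDiff ℝ ∞ φ) (hφc : HasCompactSupport φ) :
    H1.fn (smoothH1 Ω hφ hφc) =ᵐ[volume.restrict Ω] φ :=
  MemLp.coeFn_toLp (memLp_of_contDiff hφ hφc)

lemma grad_smoothH1 {φ : E d → ℝ} (hφ : ContDiff ℝ ∞ φ)
    (hφc : HasCompactSupport φ) :
    H1.grad (smoothH1 Ω hφ hφc) =ᵐ[volume.restrict Ω] gradient φ :=
  MemLp.coeFn_toLp (memLp_gradient hφ hφc)

/-- Membership in `smoothTraceGraph` prescribes only the function; the gradient component is forced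
by uniqueness of the weak gradient. -/
lemma grad_ae_eq_gradient (hΩ : IsOpen Ω) {φ : E d → ℝ} (hφ : ContDiff ℝ ∞ φ)
    (hφc : HasCompactSupport φ) {p : H1 Ω} (hp : H1.fn p =ᵐ[volume.restrict Ω] φ) :
    H1.grad p =ᵐ[volume.restrict Ω] gradient φ := by
  have h1 : H1.fn p = H1.fn (smoothH1 Ω hφ hφc) := Lp.ext (hp.trans (fn_smoothH1 hφ hφc).symm)
  have h2 : IsWeakGradient Ω (H1.fn p) (H1.grad p) := p.2
  have h3 : IsWeakGradient Ω (H1.fn (smoothH1 Ω hφ hφc)) (H1.grad (smoothH1 Ω hφ hφc)) :=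
    (smoothH1 Ω hφ hφc).2
  rw [h1] at h2
  rw [h2.unique hΩ h3]
  exact grad_smoothH1 hφ hφc

end WeakGradient

/-! ### Green's formula and existence of the normal trace. -/

section NormalTrace

variable {d : ℕ} {Ω : Set (E d)}

/-- `H1.fn` as a continuous linear map. -/
def H1.fnL (Ω : Set (E d)) : H1 Ω →L[ℝ] L2 Ω :=
  (WithLp.fstL 2 ℝ (L2 Ω) (L2Vec Ω)).comp (H1 Ω).subtypeL

/-- `H1.grad` as a continuous linear map. -/
def H1.gradL (Ω : Set (E d)) : H1 Ω →L[ℝ] L2Vec Ω :=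
  (WithLp.sndL 2 ℝ (L2 Ω) (L2Vec Ω)).comp (H1 Ω).subtypeL

lemma H1.norm_sq (w : H1 Ω) : ‖w‖ ^ 2 = ‖H1.fn w‖ ^ 2 + ‖H1.grad w‖ ^ 2 :=
  WithLp.prod_norm_sq_eq_of_L2 w.1

lemma H1.norm_fn_le (w : H1 Ω) : ‖H1.fn w‖ ≤ ‖w‖ :=
  le_of_sq_le_sq (by rw [H1.norm_sq]; linarith [sq_nonneg ‖H1.grad w‖]) (norm_nonneg _)

lemma H1.norm_grad_le (w : H1 Ω) : ‖H1.grad w‖ ≤ ‖w‖ :=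
  le_of_sq_le_sq (by rw [H1.norm_sq]; linarith [sq_nonneg ‖H1.fn w‖]) (norm_nonneg _)

lemma eLpNorm_fn_le (p : H1 Ω) : eLpNorm (H1.fn p) 2 (volume.restrict Ω) ≤ ‖p‖ₑ := by
  rw [← Lp.enorm_def]
  exact enorm_le_iff_norm_le.2 (H1.norm_fn_le p)

lemma eLpNorm_grad_le (p : H1 Ω) : eLpNorm (H1.grad p) 2 (volume.restrict Ω) ≤ ‖p‖ₑ := by
  rw [← Lp.enorm_def]
  exact enorm_le_iff_norm_le.2 (H1.norm_grad_le p)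

lemma IsTrace.add {u v : H1 Ω} {g h : L2Bd Ω} (hu : IsTrace Ω u g) (hv : IsTrace Ω v h) :
    IsTrace Ω (u + v) (g + h) := by
  have := (traceGraph Ω).add_mem hu hv
  rwa [Prod.mk_add_mk] at this

lemma IsTrace.sub {u v : H1 Ω} {g h : L2Bd Ω} (hu : IsTrace Ω u g) (hv : IsTrace Ω v h) :
    IsTrace Ω (u - v) (g - h) := by
  have := (traceGraph Ω).sub_mem hu hv
  rwa [Prod.mk_sub_mk] at this

lemma IsTrace.smul {u : H1 Ω} {g : L2Bd Ω} (c : ℝ) (hu : IsTrace Ω u g) :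
    IsTrace Ω (c • u) (c • g) := by
  have := (traceGraph Ω).smul_mem c hu
  rwa [Prod.smul_mk] at this

lemma exists_isTrace (g : HHalf Ω) : ∃ w : H1 Ω, IsTrace Ω w g := by
  obtain ⟨⟨w, g'⟩, hw, hg⟩ := g.2
  refine ⟨w, ?_⟩
  rw [← hg]
  exact hw

/-- A closed property of pairs that holds for smooth functions holds for traces. -/
lemma IsTrace.induction_closed {P : H1 Ω → L2Bd Ω → Prop}
    (hP : IsClosed {p : H1 Ω × L2Bd Ω | P p.1 p.2})
    (h : ∀ p ∈ smoothTraceGraph Ω, P p.1 p.2) {u : H1 Ω} {g : L2Bd Ω} (hu : IsTrace Ω u g) :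
    P u g := by
  have h1 : (u, g) ∈ closure (smoothTraceGraph Ω : Set (H1 Ω × L2Bd Ω)) := by
    rw [← Submodule.topologicalClosure_coe]
    exact hu
  exact closure_minimal (t := {p : H1 Ω × L2Bd Ω | P p.1 p.2}) (fun p hp => h p hp) hP h1

lemma integral_mul_eq_inner (u v : L2 Ω) : ∫ x in Ω, u x * v x = ⟪u, v⟫ := by
  rw [L2.inner_def]
  exact integral_congr_ae (Eventually.of_forall fun x => mul_comm _ _)

/-- The functional `w ↦ ∫_Ω ψ · ∇w + ∫_Ω (div ψ) w`. -/
def greenPairing (ψ : Hdiv Ω) : H1 Ω →L[ℝ] ℝ :=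
  (innerSL ℝ ψ.field).comp (H1.gradL Ω) + (innerSL ℝ ψ.div).comp (H1.fnL Ω)

lemma greenPairing_apply (ψ : Hdiv Ω) (w : H1 Ω) :
    greenPairing ψ w =
      (∫ x in Ω, ⟪ψ.field x, H1.grad w x⟫) + ∫ x in Ω, ψ.div x * H1.fn w x := by
  rw [integral_mul_eq_inner, ← L2.inner_def]
  rfl

lemma greenPairing_smoothH1 (ψ : Hdiv Ω) {φ : E d → ℝ} (hφ : ContDiff ℝ ∞ φ)
    (hφc : HasCompactSupport φ) :
    greenPairing ψ (smoothH1 Ω hφ hφc) =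
      (∫ x in Ω, ⟪ψ.field x, gradient φ x⟫) + ∫ x in Ω, ψ.div x * φ x := by
  rw [greenPairing_apply]
  congr 1
  · refine integral_congr_ae ?_
    filter_upwards [grad_smoothH1 (Ω := Ω) hφ hφc] with x hx
    rw [hx]
  · refine integral_congr_ae ?_
    filter_upwards [fn_smoothH1 (Ω := Ω) hφ hφc] with x hx
    rw [hx]

lemma greenPairing_testFunction (ψ : Hdiv Ω) {φ : E d → ℝ} (hφ : IsTestFunction Ω φ) :
    greenPairing ψ (smoothH1 Ω hφ.1 hφ.2.1) = 0 := by
  have h := ψ.isWeakDivergence φ hφ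
  simp only [← inner_gradient] at h
  rw [greenPairing_smoothH1, h, neg_add_cancel]

lemma eLpNorm_two_eq {α F : Type*} [MeasurableSpace α] [NormedAddCommGroup F] (μ : Measure α)
    (f : α → F) : eLpNorm f 2 μ = (∫⁻ x, ‖f x‖ₑ ^ 2 ∂μ) ^ (1 / 2 : ℝ) := by
  rw [eLpNorm_eq_lintegral_rpow_enorm_toReal (by norm_num) (by norm_num)]
  simp

lemma lintegral_enorm_mul_enorm_le {α F G : Type*} [MeasurableSpace α] [NormedAddCommGroup F]
    [NormedAddCommGroup G] {μ : Measure α} {f : α → F} {g : α → G}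
    (hf : AEStronglyMeasurable f μ) (hg : AEStronglyMeasurable g μ) :
    ∫⁻ x, ‖f x‖ₑ * ‖g x‖ₑ ∂μ ≤ eLpNorm f 2 μ * eLpNorm g 2 μ := by
  rw [eLpNorm_two_eq, eLpNorm_two_eq]
  simpa using ENNReal.lintegral_mul_le_Lp_mul_Lq μ Real.HolderConjugate.two_two
    hf.enorm hg.enorm

lemma integrable_inner_of_memLp {α F : Type*} [MeasurableSpace α] [NormedAddCommGroup F]
    [InnerProductSpace ℝ F] {μ : Measure α} {f g : α → F} (hf : MemLp f 2 μ) (hg : MemLp g 2 μ) :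
    Integrable (fun x => ⟪f x, g x⟫) μ :=
  (hf.norm.integrable_mul hg.norm).mono' (hf.1.inner hg.1)
    (Eventually.of_forall fun _ => norm_inner_le_norm _ _)

/-- The mass of a field in `H_div(Ω)` near the boundary. -/
def boundaryMass (ψ : Hdiv Ω) (ε : ℝ) : ℝ≥0∞ :=
  eLpNorm ψ.field 2 (volume.restrict (Ω ∩ Metric.thickening ε (frontier Ω))) +
    eLpNorm ψ.div 2 (volume.restrict (Ω ∩ Metric.thickening ε (frontier Ω)))

lemma boundaryMass_ne_top (ψ : Hdiv Ω) (ε : ℝ) : boundaryMass ψ ε ≠ ⊤ :=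
  ENNReal.add_ne_top.2
    ⟨((Lp.memLp ψ.field).mono_measure (Measure.restrict_mono inter_subset_left le_rfl)).2.ne,
      ((Lp.memLp ψ.div).mono_measure (Measure.restrict_mono inter_subset_left le_rfl)).2.ne⟩

/-- The layers shrink to `Ω ∩ ∂Ω`, which is empty because `Ω` is open; boundedness gives finite
measure, and absolute continuity of the integral concludes. The frontier need not be Lebesgue-null.
-/
lemma tendsto_eLpNorm_layer {F : Type*} [NormedAddCommGroup F] (hΩ : IsOpen Ω)
    (hΩb : Bornology.IsBounded Ω) {f : E d → F} (hf : MemLp f 2 (volume.restrict Ω)) :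
    Tendsto (fun ε => eLpNorm f 2 (volume.restrict (Ω ∩ Metric.thickening ε (frontier Ω))))
      (𝓝[>] 0) (𝓝 0) := by
  simp only [eLpNorm_two_eq]
  have h1 : Tendsto (fun ε => volume.restrict Ω (Metric.thickening ε (frontier Ω)))
      (𝓝[>] 0) (𝓝 (volume.restrict Ω (frontier Ω))) := by
    refine tendsto_measure_thickening_of_isClosed ⟨1, one_pos, ?_⟩ isClosed_frontier
    exact ((measure_mono (subset_univ _)).trans_lt (by
      rw [Measure.restrict_apply_univ]; exact hΩb.measure_lt_top)).ne
  have h2 : volume.restrict Ω (frontier Ω) = 0 := by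
    rw [Measure.restrict_apply isClosed_frontier.measurableSet, inter_comm,
      hΩ.inter_frontier_eq, measure_empty]
  rw [h2] at h1
  have hfin : ∫⁻ x in Ω, ‖f x‖ₑ ^ 2 ≠ ⊤ := by
    have := hf.2
    rw [eLpNorm_two_eq] at this
    intro h
    rw [h] at this
    simp at this
  have h3 := (tendsto_setLIntegral_zero hfin h1).ennrpow_const (1 / 2 : ℝ)
  rw [ENNReal.zero_rpow_of_pos (by norm_num)] at h3
  refine h3.congr fun ε => ?_
  rw [Measure.restrict_restrict Metric.isOpen_thickening.measurableSet, inter_comm]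

lemma tendsto_boundaryMass (hΩ : IsOpen Ω) (hΩb : Bornology.IsBounded Ω) (ψ : Hdiv Ω) :
    Tendsto (boundaryMass ψ) (𝓝[>] 0) (𝓝 0) := by
  have h := (tendsto_eLpNorm_layer hΩ hΩb (Lp.memLp ψ.field)).add
    (tendsto_eLpNorm_layer hΩ hΩb (Lp.memLp ψ.div))
  rwa [add_zero] at h

/-- Taking square roots, the gradient term keeps a full factor ε, exactly what absorbs the 4/ε of
the cut-off. The boundary term keeps only √ε. -/
lemma eLpNorm_layer_le {C : ℝ≥0} {ε : ℝ} (hε : 0 < ε) {φ : E d → ℝ}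
    (h : ∫⁻ x in Ω ∩ Metric.thickening ε (frontier Ω), ‖φ x‖ₑ ^ 2 ≤
      C * (ENNReal.ofReal ε * ∫⁻ x, ‖φ x‖ₑ ^ 2 ∂(surfaceMeasure Ω)
        + ENNReal.ofReal ε ^ 2 * ∫⁻ x in Ω, ‖fderiv ℝ φ x‖ₑ ^ 2)) :
    eLpNorm φ 2 (volume.restrict (Ω ∩ Metric.thickening ε (frontier Ω))) ≤
      NNReal.sqrt C * (ENNReal.ofReal (√ε) * eLpNorm φ 2 (surfaceMeasure Ω)
        + ENNReal.ofReal ε * eLpNorm (gradient φ) 2 (volume.restrict Ω)) := by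
  have e1 : ∀ x, ‖gradient φ x‖ₑ = ‖fderiv ℝ φ x‖ₑ := fun x => by
    rw [← ofReal_norm, ← ofReal_norm, norm_gradient]
  simp only [eLpNorm_two_eq, e1]
  refine (ENNReal.rpow_le_rpow h (by norm_num)).trans ?_
  rw [ENNReal.mul_rpow_of_nonneg _ _ (by norm_num)]
  have e2 : (C : ℝ≥0∞) ^ (1 / 2 : ℝ) = NNReal.sqrt C := by
    rw [NNReal.sqrt_eq_rpow, ENNReal.coe_rpow_of_nonneg _ (by norm_num)]
  have e3 : ENNReal.ofReal ε ^ (1 / 2 : ℝ) = ENNReal.ofReal (√ε) := by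
    rw [Real.sqrt_eq_rpow, ENNReal.ofReal_rpow_of_pos hε]
  have e4 : (ENNReal.ofReal ε ^ 2) ^ (1 / 2 : ℝ) = ENNReal.ofReal ε := by
    rw [← ENNReal.rpow_natCast, ← ENNReal.rpow_mul]; simp
  rw [e2]
  gcongr
  refine (ENNReal.rpow_add_le_add_rpow _ _ (by norm_num) (by norm_num)).trans_eq ?_
  rw [ENNReal.mul_rpow_of_nonneg _ _ (by norm_num), ENNReal.mul_rpow_of_nonneg _ _ (by norm_num),
    e3, e4]

/-- Green's pairing against a smooth function only sees the mass of the field near the boundary. -/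
lemma enorm_greenPairing_smoothH1_le (hΩ : IsOpen Ω) (hΩb : Bornology.IsBounded Ω)
    (hΩu : Ω ≠ univ) (ψ : Hdiv Ω) {φ : E d → ℝ} (hφ : ContDiff ℝ ∞ φ) (hφc : HasCompactSupport φ)
    {ε : ℝ} (hε : 0 < ε) :
    ‖greenPairing ψ (smoothH1 Ω hφ hφc)‖ₑ ≤ boundaryMass ψ ε *
      (eLpNorm (gradient φ) 2 (volume.restrict Ω) + eLpNorm φ 2 (volume.restrict Ω) +
        ENNReal.ofReal (4 / ε) *
          eLpNorm φ 2 (volume.restrict (Ω ∩ Metric.thickening ε (frontier Ω)))) := by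
  obtain ⟨χ, hχ, hχs, hχ01, hχ1, hχd⟩ := exists_smooth_cutoff hΩu hε
  set L := Ω ∩ Metric.thickening ε (frontier Ω) with hL
  have hLm : MeasurableSet L := hΩ.measurableSet.inter Metric.isOpen_thickening.measurableSet
  have hLΩ : L ⊆ Ω := inter_subset_left
  have hχc : HasCompactSupport χ :=
    hΩb.isCompact_closure.of_isClosed_subset (isClosed_tsupport χ) (hχs.trans subset_closure)
  have hη : IsTestFunction Ω (fun x => χ x * φ x) :=
    ⟨hχ.mul hφ, hχc.mul_right, (tsupport_mul_subset_left).trans hχs⟩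
  have hzero := greenPairing_testFunction ψ hη
  have hdiff : ∀ x, gradient (fun x => χ x * φ x) x = χ x • gradient φ x + φ x • gradient χ x := by
    intro x
    have h1 := ((hχ.differentiable (by simp) x).hasFDerivAt).mul
      ((hφ.differentiable (by simp) x).hasFDerivAt)
    unfold gradient
    rw [show (fun x => χ x * φ x) = χ * φ from rfl, h1.fderiv, map_add, map_smulₛₗ, map_smulₛₗ]
    rfl
  have hdecomp : greenPairing ψ (smoothH1 Ω hφ hφc) = ∫ x in L,
      (⟪ψ.field x, gradient φ x - gradient (fun x => χ x * φ x) x⟫ +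
        ψ.div x * (φ x - χ x * φ x)) := by
    have i1 : Integrable (fun x => ⟪ψ.field x, gradient φ x⟫) (volume.restrict Ω) :=
      integrable_inner_of_memLp (Lp.memLp ψ.field) (memLp_gradient hφ hφc)
    have i2 : Integrable (fun x => ⟪ψ.field x, gradient (fun x => χ x * φ x) x⟫)
        (volume.restrict Ω) :=
      integrable_inner_of_memLp (Lp.memLp ψ.field) (memLp_gradient hη.1 hη.2.1)
    have i3 : Integrable (fun x => ψ.div x * φ x) (volume.restrict Ω) :=
      (Lp.memLp ψ.div).integrable_mul (memLp_of_contDiff hφ hφc)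
    have i4 : Integrable (fun x => ψ.div x * (χ x * φ x)) (volume.restrict Ω) :=
      (Lp.memLp ψ.div).integrable_mul (memLp_of_contDiff hη.1 hη.2.1)
    -- Subtracting the vanishing pairing with `χφ` leaves `φ - χφ`, whose contribution is confined
    -- to the layer.
    rw [← sub_zero (greenPairing ψ _), ← hzero, greenPairing_smoothH1, greenPairing_smoothH1]
    trans ∫ x in Ω, (⟪ψ.field x, gradient φ x - gradient (fun x => χ x * φ x) x⟫ +
        ψ.div x * (φ x - χ x * φ x))
    · rw [add_sub_add_comm, ← integral_sub i1 i2, ← integral_sub i3 i4]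
      refine (integral_add (i1.sub i2) (i3.sub i4)).symm.trans
        (integral_congr_ae (Eventually.of_forall fun x => ?_))
      simp only [inner_sub_right, mul_sub, Pi.sub_apply]
    · refine setIntegral_eq_of_subset_of_forall_sdiff_eq_zero hΩ.measurableSet hLΩ ?_
      rintro x ⟨hxΩ, hxL⟩
      have hx1 : χ x = 1 := hχ1 x hxΩ fun h => hxL ⟨hxΩ, h⟩
      -- The value 1 is the maximum of `χ`, so its gradient vanishes at `x` even if `χ` is not
      -- constant near `x`.
      have hx2 : gradient χ x = 0 := by
        have : IsLocalMax χ x := Eventually.of_forall fun y => by rw [hx1]; exact (hχ01 y).2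
        rw [gradient, this.fderiv_eq_zero, map_zero]
      rw [hdiff, hx1, hx2]
      simp
  have hpt : ∀ x, ‖⟪ψ.field x, gradient φ x - gradient (fun x => χ x * φ x) x⟫ +
        ψ.div x * (φ x - χ x * φ x)‖ₑ ≤ ‖ψ.field x‖ₑ * ‖gradient φ x‖ₑ +
        ENNReal.ofReal (4 / ε) * (‖ψ.field x‖ₑ * ‖φ x‖ₑ) + ‖ψ.div x‖ₑ * ‖φ x‖ₑ := by
    intro x
    simp only [← ofReal_norm]
    rw [← ENNReal.ofReal_mul (norm_nonneg _), ← ENNReal.ofReal_mul (norm_nonneg _),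
      ← ENNReal.ofReal_mul (norm_nonneg _), ← ENNReal.ofReal_mul (by positivity),
      ← ENNReal.ofReal_add (by positivity) (by positivity),
      ← ENNReal.ofReal_add (by positivity) (by positivity)]
    refine ENNReal.ofReal_le_ofReal ?_
    have h0 : ‖1 - χ x‖ ≤ 1 := by
      rw [Real.norm_eq_abs, abs_le]
      constructor <;> linarith [(hχ01 x).1, (hχ01 x).2]
    have h1 : ‖gradient φ x - gradient (fun x => χ x * φ x) x‖
        ≤ ‖gradient φ x‖ + 4 / ε * ‖φ x‖ := by
      have : gradient φ x - gradient (fun x => χ x * φ x) x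
          = (1 - χ x) • gradient φ x - φ x • gradient χ x := by
        rw [hdiff, sub_smul, one_smul]; abel
      rw [this]
      refine (norm_sub_le _ _).trans (add_le_add ?_ ?_)
      · rw [norm_smul]
        exact mul_le_of_le_one_left (norm_nonneg _) h0
      · rw [norm_smul, mul_comm, norm_gradient]
        exact mul_le_mul_of_nonneg_right (hχd x) (norm_nonneg _)
    have h2 : ‖φ x - χ x * φ x‖ ≤ ‖φ x‖ := by
      rw [← one_sub_mul, norm_mul]
      exact mul_le_of_le_one_left (norm_nonneg _) h0
    calc _ ≤ ‖ψ.field x‖ * (‖gradient φ x‖ + 4 / ε * ‖φ x‖) + ‖ψ.div x‖ * ‖φ x‖ := by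
          refine (norm_add_le _ _).trans (add_le_add ?_ ?_)
          · exact (norm_inner_le_norm _ _).trans (mul_le_mul_of_nonneg_left h1 (norm_nonneg _))
          · rw [norm_mul]
            exact mul_le_mul_of_nonneg_left h2 (norm_nonneg _)
      _ = _ := by ring
  have mL : ∀ {F : Type} [NormedAddCommGroup F] {f : E d → F},
      AEStronglyMeasurable f (volume.restrict Ω) → AEStronglyMeasurable f (volume.restrict L) :=
    fun hf => hf.mono_measure (Measure.restrict_mono hLΩ le_rfl)
  have mψ := mL (Lp.aestronglyMeasurable ψ.field)
  have mδ := mL (Lp.aestronglyMeasurable ψ.div)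
  have mφ : AEStronglyMeasurable φ (volume.restrict L) := hφ.continuous.aestronglyMeasurable
  have mg : AEStronglyMeasurable (gradient φ) (volume.restrict L) :=
    (continuous_gradient hφ).aestronglyMeasurable
  have eL : ∀ {F : Type} [NormedAddCommGroup F] (f : E d → F),
      eLpNorm f 2 (volume.restrict L) ≤ eLpNorm f 2 (volume.restrict Ω) :=
    fun f => eLpNorm_mono_measure f (Measure.restrict_mono hLΩ le_rfl)
  rw [hdecomp]
  calc _ ≤ ∫⁻ x in L, (‖ψ.field x‖ₑ * ‖gradient φ x‖ₑ +
        ENNReal.ofReal (4 / ε) * (‖ψ.field x‖ₑ * ‖φ x‖ₑ) + ‖ψ.div x‖ₑ * ‖φ x‖ₑ) :=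
        (enorm_integral_le_lintegral_enorm _).trans (lintegral_mono hpt)
    _ = (∫⁻ x in L, ‖ψ.field x‖ₑ * ‖gradient φ x‖ₑ) +
        ENNReal.ofReal (4 / ε) * (∫⁻ x in L, ‖ψ.field x‖ₑ * ‖φ x‖ₑ)
          + ∫⁻ x in L, ‖ψ.div x‖ₑ * ‖φ x‖ₑ := by
        rw [lintegral_add_right' _ (by fun_prop), lintegral_add_left' (by fun_prop),
          lintegral_const_mul' _ _ (by finiteness)]
    _ ≤ boundaryMass ψ ε * eLpNorm (gradient φ) 2 (volume.restrict Ω)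
        + ENNReal.ofReal (4 / ε) * (boundaryMass ψ ε * eLpNorm φ 2 (volume.restrict L))
        + boundaryMass ψ ε * eLpNorm φ 2 (volume.restrict Ω) := by
        refine add_le_add (add_le_add ?_ ?_) ?_
        · exact (lintegral_enorm_mul_enorm_le mψ mg).trans (mul_le_mul' le_self_add (eL _))
        · gcongr
          exact (lintegral_enorm_mul_enorm_le mψ mφ).trans (mul_le_mul' le_self_add le_rfl)
        · exact (lintegral_enorm_mul_enorm_le mδ mφ).trans (mul_le_mul' le_add_self (eL _))
    _ = _ := by ring

/-- The order of quantifiers is the point: `c` is independent of ε, while `D`, of order ε^{-1/2},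
may blow up because it only multiplies the boundary norm. In `c`, the 2 comes from the norms of `φ`
and its gradient, and `4 √C` from `(4/ε) · ε`. -/
lemma enorm_greenPairing_smoothH1_le_trace (hd : 1 ≤ d) (hΩ : IsOpen Ω)
    (hΩb : Bornology.IsBounded Ω) (hΩu : Ω ≠ univ) (hΩL : HasLipschitzBoundary Ω) :
    ∃ c : ℝ≥0, ∃ ε₀ > 0, ∀ ε, 0 < ε → ε < ε₀ → ∃ D : ℝ≥0, ∀ (ψ : Hdiv Ω) (φ : E d → ℝ)
      (hφ : ContDiff ℝ ∞ φ) (hφc : HasCompactSupport φ) (P Q : ℝ≥0∞),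
      eLpNorm φ 2 (volume.restrict Ω) ≤ P → eLpNorm (gradient φ) 2 (volume.restrict Ω) ≤ P →
      eLpNorm φ 2 (surfaceMeasure Ω) = Q →
      ‖greenPairing ψ (smoothH1 Ω hφ hφc)‖ₑ ≤ boundaryMass ψ ε * (c * P + D * Q) := by
  obtain ⟨C, ε₀, hε₀, hC⟩ := layerEstimate_frontier hd hΩ hΩb hΩL
  refine ⟨2 + 4 * NNReal.sqrt C, ε₀, hε₀, fun ε h0 h1 =>
    ⟨Real.toNNReal (4 / ε) * NNReal.sqrt C * Real.toNNReal √ε, ?_⟩⟩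
  rintro ψ φ hφ hφc P Q hpf hpg hq
  have hlayer := eLpNorm_layer_le h0 (hC ε h0 h1 φ (hφ.of_le (by simp)))
  have h4 : ENNReal.ofReal (4 / ε) * ENNReal.ofReal ε = 4 := by
    rw [← ENNReal.ofReal_mul (by positivity), div_mul_cancel₀ _ h0.ne']
    norm_num
  have hmain := enorm_greenPairing_smoothH1_le hΩ hΩb hΩu ψ hφ hφc h0
  have hlayer' : eLpNorm φ 2 (volume.restrict (Ω ∩ Metric.thickening ε (frontier Ω))) ≤
      NNReal.sqrt C * (ENNReal.ofReal (√ε) * Q + ENNReal.ofReal ε * P) := by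
    rw [← hq]
    exact hlayer.trans (mul_le_mul' le_rfl (add_le_add le_rfl (mul_le_mul' le_rfl hpg)))
  have hbound := hmain.trans (mul_le_mul' le_rfl
    (add_le_add (add_le_add hpg hpf) (mul_le_mul' le_rfl hlayer')))
  have hofReal : ∀ t, ENNReal.ofReal t = (Real.toNNReal t : ℝ≥0∞) := fun _ => rfl
  refine hbound.trans_eq ?_
  rw [ENNReal.coe_add, ENNReal.coe_mul, ENNReal.coe_mul, ENNReal.coe_mul, ← hofReal, ← hofReal]
  push_cast
  rw [← h4]
  ring

lemma eq_smoothH1 (hΩ : IsOpen Ω) {φ : E d → ℝ} (hφ : ContDiff ℝ ∞ φ) (hφc : HasCompactSupport φ)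
    {p : H1 Ω} (hp : H1.fn p =ᵐ[volume.restrict Ω] φ) : p = smoothH1 Ω hφ hφc := by
  have h1 : H1.fn p = H1.fn (smoothH1 Ω hφ hφc) := Lp.ext (hp.trans (fn_smoothH1 hφ hφc).symm)
  have h2 : H1.grad p = H1.grad (smoothH1 Ω hφ hφc) :=
    Lp.ext ((grad_ae_eq_gradient hΩ hφ hφc hp).trans (grad_smoothH1 hφ hφc).symm)
  exact Subtype.ext ((WithLp.ofLp_injective 2) (Prod.ext h1 h2))

/-- Here both sides are continuous in the pair (function, boundary value), so the bound survives the
closure that defines the trace. -/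
lemma enorm_greenPairing_le_of_mem_smoothTraceGraph (hd : 1 ≤ d) (hΩ : IsOpen Ω)
    (hΩb : Bornology.IsBounded Ω) (hΩu : Ω ≠ univ) (hΩL : HasLipschitzBoundary Ω) :
    ∃ c : ℝ≥0, ∃ ε₀ > 0, ∀ ε, 0 < ε → ε < ε₀ → ∃ D : ℝ≥0, ∀ ψ : Hdiv Ω,
      ∀ p ∈ smoothTraceGraph Ω, ‖greenPairing ψ p.1‖ₑ ≤
        boundaryMass ψ ε * (c * ‖p.1‖ₑ + D * ‖p.2‖ₑ) := by
  refine (enorm_greenPairing_smoothH1_le_trace hd hΩ hΩb hΩu hΩL).elim fun c hc =>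
    hc.elim fun ε₀ hc => ?_
  refine ⟨c, ε₀, hc.1, fun ε h0 h1 => ?_⟩
  refine (hc.2 ε h0 h1).elim fun D hD => ?_
  refine ⟨D, fun ψ p hp => ?_⟩
  obtain ⟨φ, hφ, hφc, hpφ, hqφ⟩ := hp
  have hle := hD ψ φ hφ hφc ‖p.1‖ₑ ‖p.2‖ₑ
    ((eLpNorm_congr_ae hpφ.symm).trans_le (eLpNorm_fn_le p.1))
    ((eLpNorm_congr_ae (grad_ae_eq_gradient hΩ hφ hφc hpφ).symm).trans_le (eLpNorm_grad_le p.1))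
    ((eLpNorm_congr_ae hqφ.symm).trans (Lp.enorm_def p.2).symm)
  exact (congrArg (fun u => ‖greenPairing ψ u‖ₑ) (eq_smoothH1 hΩ hφ hφc hpφ)).trans_le hle

/-- **Green's formula** for functions of `H¹(Ω)` with zero trace. -/
lemma greenPairing_eq_zero_of_isTrace_zero (hd : 1 ≤ d) (hΩ : IsOpen Ω)
    (hΩb : Bornology.IsBounded Ω) (hΩu : Ω ≠ univ) (hΩL : HasLipschitzBoundary Ω) (ψ : Hdiv Ω)
    {w : H1 Ω} (hw : IsTrace Ω w 0) : greenPairing ψ w = 0 := by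
  refine (enorm_greenPairing_le_of_mem_smoothTraceGraph hd hΩ hΩb hΩu hΩL).elim fun c hc =>
    hc.elim fun ε₀ hc => ?_
  -- With ε fixed the bound passes to the closure, and the zero trace cancels the term with `D`.
  -- Only then may ε tend to 0.
  have hle : ∀ ε, 0 < ε → ε < ε₀ → ‖greenPairing ψ w‖ₑ ≤ boundaryMass ψ ε * (c * ‖w‖ₑ) := by
    intro ε h0 h1
    refine (hc.2 ε h0 h1).elim fun D hD => ?_
    have hcl : IsClosed {p : H1 Ω × L2Bd Ω | ‖greenPairing ψ p.1‖ₑ ≤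
        boundaryMass ψ ε * (c * ‖p.1‖ₑ + D * ‖p.2‖ₑ)} := by
      refine isClosed_le (by fun_prop) ?_
      refine (ENNReal.continuous_const_mul (boundaryMass_ne_top ψ ε)).comp
        (g := fun r => boundaryMass ψ ε * r)
        (f := fun p : H1 Ω × L2Bd Ω => c * ‖p.1‖ₑ + D * ‖p.2‖ₑ) ?_
      exact ((ENNReal.continuous_const_mul ENNReal.coe_ne_top).comp
          (continuous_enorm.comp continuous_fst)).add
        ((ENNReal.continuous_const_mul ENNReal.coe_ne_top).comp
          (continuous_enorm.comp continuous_snd))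
    have hmem := IsTrace.induction_closed (P := fun u g => ‖greenPairing ψ u‖ₑ ≤
      boundaryMass ψ ε * (c * ‖u‖ₑ + D * ‖g‖ₑ)) hcl (hD ψ) hw
    have hz : (D : ℝ≥0∞) * ‖(0 : L2Bd Ω)‖ₑ = 0 := by rw [enorm_zero (E := L2Bd Ω), mul_zero]
    rwa [hz, add_zero] at hmem
  have hlim : Tendsto (fun ε => boundaryMass ψ ε * (c * ‖w‖ₑ)) (𝓝[>] 0) (𝓝 0) := by
    have := ENNReal.Tendsto.mul_const (b := c * ‖w‖ₑ) (tendsto_boundaryMass hΩ hΩb ψ)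
      (Or.inr (by finiteness))
    simpa using this
  have h0 : ‖greenPairing ψ w‖ₑ ≤ 0 := by
    refine ge_of_tendsto hlim ?_
    filter_upwards [Ioo_mem_nhdsGT hc.1] with ε hε
    exact hle ε hε.1 hε.2
  rwa [nonpos_iff_eq_zero, enorm_eq_zero] at h0

/-- The normal trace exists on bounded Lipschitz domains. -/
lemma isNormalTrace_normalTrace (hd : 1 ≤ d) (hΩ : IsOpen Ω)
    (hΩb : Bornology.IsBounded Ω) (hΩu : Ω ≠ univ) (hΩL : HasLipschitzBoundary Ω) (ψ : Hdiv Ω) :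
    IsNormalTrace ψ (normalTrace ψ) := by
  choose w hw using exists_isTrace (Ω := Ω)
  -- The pairing depends only on the trace, so arbitrarily chosen liftings `w g` still define a
  -- linear functional of `g`.
  have huniq : ∀ {u v : H1 Ω} {g : L2Bd Ω}, IsTrace Ω u g → IsTrace Ω v g →
      greenPairing ψ u = greenPairing ψ v := by
    intro u v g hu hv
    have h := hu.sub hv
    rw [sub_self] at h
    rw [← sub_eq_zero, ← map_sub]
    exact greenPairing_eq_zero_of_isTrace_zero hd hΩ hΩb hΩu hΩL ψ h
  let ℓ : Module.Dual ℝ (HHalf Ω) :=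
    { toFun := fun g => greenPairing ψ (w g)
      map_add' := fun g h => by
        rw [← map_add]
        exact huniq (hw (g + h)) ((hw g).add (hw h))
      map_smul' := fun c g => by
        rw [RingHom.id_apply, ← map_smul]
        exact huniq (hw (c • g)) ((hw g).smul c) }
  have hex : ∃ ℓ, IsNormalTrace ψ ℓ :=
    ⟨ℓ, fun v g hv => (huniq (hw g) hv).trans (greenPairing_apply ψ v)⟩
  rw [normalTrace, dif_pos hex]
  exact hex.choose_spec

end NormalTrace

/-! ### Variational inequalities in finite dimension. -/

section FiniteDimensional

variable {X : Type*} [AddCommGroup X] [Module ℝ X] [FiniteDimensional ℝ X]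

/-- Linear maps on a finite dimensional space are bounded with respect to any norm. -/
lemma exists_norm_le_of_finiteDimensional {V F : Type*} [NormedAddCommGroup V] [NormedSpace ℝ V]
    [NormedAddCommGroup F] [NormedSpace ℝ F] (N : X →ₗ[ℝ] V) (hN : ∀ v, ‖N v‖ = 0 → v = 0)
    (L : X →ₗ[ℝ] F) : ∃ C, 0 ≤ C ∧ ∀ v, ‖L v‖ ≤ C * ‖N v‖ := by
  have hinj : Function.Injective N :=
    (injective_iff_map_eq_zero N).2 fun v hv => hN v (by rw [hv, norm_zero])
  let _ : NormedAddCommGroup X := NormedAddCommGroup.induced X V N hinj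
  let _ : NormedSpace ℝ X := NormedSpace.induced ℝ X V N
  exact ⟨‖LinearMap.toContinuousLinearMap L‖, norm_nonneg _,
    (LinearMap.toContinuousLinearMap L).le_opNorm⟩

/-- Symmetric variational inequalities on a finite dimensional space have a unique solution. -/
lemma existsUnique_variationalInequality {F : Type*} [NormedAddCommGroup F] [NormedSpace ℝ F]
    (B : X →ₗ[ℝ] X →ₗ[ℝ] ℝ) (hsymm : ∀ u v, B u v = B v u) (hpos : ∀ v, v ≠ 0 → 0 < B v v)
    (T : X →ₗ[ℝ] F) {C : Set F} (hC : IsClosed C) (hCc : Convex ℝ C) (hne : ∃ v, T v ∈ C)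
    (L : X →ₗ[ℝ] ℝ) :
    ∃! u, T u ∈ C ∧ ∀ v, T v ∈ C → B u (u - v) ≤ L (u - v) := by
  let core : InnerProductSpace.Core ℝ X :=
    { inner := fun u v => B u v
      conj_inner_symm := fun u v => hsymm v u
      re_inner_nonneg := fun v => by
        rcases eq_or_ne v 0 with rfl | hv
        · simp
        · exact (hpos v hv).le
      add_left := fun u v w => by simp
      smul_left := fun u v c => by simp
      definite := fun v hv => by
        by_contra h
        exact (hpos v h).ne' hv }
  let _ : NormedAddCommGroup X := core.toNormedAddCommGroup
  let _ : InnerProductSpace ℝ X := InnerProductSpace.ofCore core.toCore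
  have hinner : ∀ u v : X, ⟪u, v⟫ = B u v := fun _ _ => rfl
  have : CompleteSpace X := FiniteDimensional.complete ℝ X
  -- No topology on `X` is given beforehand; closedness of the constraint is pulled back from `F`.
  have hTc : Continuous T := T.continuous_of_finiteDimensional
  have hKc : IsClosed (T ⁻¹' C) := hC.preimage hTc
  have hKconv : Convex ℝ (T ⁻¹' C) := hCc.linear_preimage T
  -- With `p` the Riesz representative of `L` for `B`, the inequality is the characterisation of the
  -- projection of `p` onto `T ⁻¹' C`.
  set p : X := (InnerProductSpace.toDual ℝ X).symm (LinearMap.toContinuousLinearMap L) with hp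
  have hpL : ∀ v, B p v = L v := fun v => by
    rw [← hinner, hp, InnerProductSpace.toDual_symm_apply]
    rfl
  obtain ⟨u, hu, hmin⟩ := exists_norm_eq_iInf_of_complete_convex (K := T ⁻¹' C) hne
    hKc.isComplete hKconv p
  rw [norm_eq_iInf_iff_real_inner_le_zero hKconv hu] at hmin
  have hmin' : ∀ w, T w ∈ C → L (w - u) ≤ B u (w - u) := fun w hw => by
    have h := hmin w hw
    rw [inner_sub_left, hinner, hinner, hpL] at h
    linarith
  refine ⟨u, ⟨hu, fun v hv => ?_⟩, fun w ⟨hw, hwv⟩ => ?_⟩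
  · have h := hmin' v hv
    rw [← neg_sub v u, map_neg, map_neg]
    linarith
  · have h1 := hwv u hu
    have h2 := hmin' w hw
    by_contra hne
    have h3 := hpos (w - u) (sub_ne_zero.2 hne)
    have h4 : B (w - u) (w - u) = B w (w - u) - B u (w - u) := by
      rw [LinearMap.map_sub B w u, LinearMap.sub_apply]
    linarith

end FiniteDimensional

/-! ### The flux operator and its spectral bounds. -/

section Diffusion

variable {d : ℕ} {Ω : Set (E d)}

lemma inner_toEuclideanLin_comm {A : Matrix (Fin d) (Fin d) ℝ} (hA : A.IsSymm) (x y : E d) :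
    ⟪Matrix.toEuclideanLin A x, y⟫ = ⟪x, Matrix.toEuclideanLin A y⟫ := by
  have hH : A.IsHermitian := by
    rw [Matrix.IsHermitian, Matrix.conjTranspose_eq_transpose_of_trivial]; exact hA
  exact (Matrix.isSymmetric_toEuclideanLin_iff.2 hH) x y

section Spectral

variable {A : Matrix (Fin d) (Fin d) ℝ} {lam Lam : ℝ}

/-- Spectral decomposition of a symmetric matrix with eigenvalues in `[lam, Lam]`. -/
lemma exists_orthonormalBasis_of_eigenvalues_mem (hA : A.IsSymm)
    (hev : ∀ μ, Module.End.HasEigenvalue (Matrix.toLin' A) μ → μ ∈ Icc lam Lam) :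
    ∃ (b : OrthonormalBasis (Fin d) ℝ (E d)) (μ : Fin d → ℝ), (∀ i, μ i ∈ Icc lam Lam) ∧
      ∀ i x, ⟪b i, Matrix.toEuclideanLin A x⟫ = μ i * ⟪b i, x⟫ := by
  have hH : A.IsHermitian := by
    rw [Matrix.IsHermitian, Matrix.conjTranspose_eq_transpose_of_trivial]; exact hA
  have hb : ∀ i, Matrix.toEuclideanLin A (hH.eigenvectorBasis i)
      = hH.eigenvalues i • hH.eigenvectorBasis i := by
    intro i
    have := hH.mulVec_eigenvectorBasis i
    ext j
    exact congrFun this j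
  refine ⟨hH.eigenvectorBasis, hH.eigenvalues, fun i => hev _ ?_, fun i x => ?_⟩
  · refine Module.End.hasEigenvalue_of_hasEigenvector
      (x := (hH.eigenvectorBasis i : Fin d → ℝ)) ⟨?_, ?_⟩
    · rw [Module.End.mem_eigenspace_iff, Matrix.toLin'_apply]
      exact hH.mulVec_eigenvectorBasis i
    · intro h0
      refine hH.eigenvectorBasis.orthonormal.ne_zero i ?_
      ext j
      exact congrFun h0 j
  · rw [← inner_toEuclideanLin_comm hA, hb, real_inner_smul_left]

lemma mul_norm_sq_le_inner_toEuclideanLin (hA : A.IsSymm)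
    (hev : ∀ μ, Module.End.HasEigenvalue (Matrix.toLin' A) μ → μ ∈ Icc lam Lam) (x : E d) :
    lam * ‖x‖ ^ 2 ≤ ⟪Matrix.toEuclideanLin A x, x⟫ := by
  obtain ⟨b, μ, hμ, hb⟩ := exists_orthonormalBasis_of_eigenvalues_mem hA hev
  rw [← b.sum_inner_mul_inner, ← b.sum_sq_norm_inner_right x, Finset.mul_sum]
  refine Finset.sum_le_sum fun i _ => ?_
  rw [real_inner_comm (b i), hb, Real.norm_eq_abs, sq_abs]
  nlinarith [(hμ i).1, sq_nonneg ⟪b i, x⟫]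

lemma norm_toEuclideanLin_le (hlam : 0 < lam) (hLam : 0 < Lam) (hA : A.IsSymm)
    (hev : ∀ μ, Module.End.HasEigenvalue (Matrix.toLin' A) μ → μ ∈ Icc lam Lam) (x : E d) :
    ‖Matrix.toEuclideanLin A x‖ ≤ Lam * ‖x‖ := by
  obtain ⟨b, μ, hμ, hb⟩ := exists_orthonormalBasis_of_eigenvalues_mem hA hev
  refine le_of_sq_le_sq ?_ (by positivity)
  rw [mul_pow, ← b.sum_sq_norm_inner_right x, ← b.sum_sq_norm_inner_right, Finset.mul_sum]
  refine Finset.sum_le_sum fun i _ => ?_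
  rw [hb, norm_mul, mul_pow]
  gcongr
  rw [Real.norm_eq_abs, abs_of_nonneg (hlam.le.trans (hμ i).1)]
  exact (hμ i).2

end Spectral

variable {Λ : E d → Matrix (Fin d) (Fin d) ℝ} {lam Lam : ℝ}

lemma memLp_flux (hlam : 0 < lam) (hLam : 0 < Lam) (hΛ : IsDiffusionTensor Ω Λ lam Lam)
    (G : L2Vec Ω) :
    MemLp (fun x => Matrix.toEuclideanLin (Λ x) (G x)) 2 (volume.restrict Ω) := by
  refine (Lp.memLp G).of_le_mul (c := Lam) ?_ ?_
  · have hG : ∀ i, AEMeasurable (fun x => G x i) (volume.restrict Ω) := fun i =>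
      (memLp_coord G i).1.aemeasurable
    have h1 : AEMeasurable (fun x (i : Fin d) => ∑ j, Λ x i j * G x j) (volume.restrict Ω) :=
      aemeasurable_pi_lambda _ fun i =>
        Finset.aemeasurable_fun_sum _ fun j _ => (hΛ.1 i j).mul (hG j)
    have h2 := ((WithLp.measurable_toLp 2 (Fin d → ℝ)).comp_aemeasurable h1).aestronglyMeasurable
    exact h2
  · filter_upwards [hΛ.2] with x hx
    exact norm_toEuclideanLin_le hlam hLam hx.1 hx.2 _

/-- The flux map `G ↦ ΛG` on `L²(Ω)ᵈ`. -/
def fluxMap (hlam : 0 < lam) (hLam : 0 < Lam) (hΛ : IsDiffusionTensor Ω Λ lam Lam) :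
    L2Vec Ω →ₗ[ℝ] L2Vec Ω where
  toFun G := (memLp_flux hlam hLam hΛ G).toLp _
  map_add' G H := by
    refine Lp.ext ?_
    filter_upwards [(memLp_flux hlam hLam hΛ (G + H)).coeFn_toLp,
      (memLp_flux hlam hLam hΛ G).coeFn_toLp, (memLp_flux hlam hLam hΛ H).coeFn_toLp,
      Lp.coeFn_add G H, Lp.coeFn_add ((memLp_flux hlam hLam hΛ G).toLp _)
        ((memLp_flux hlam hLam hΛ H).toLp _)] with x h1 h2 h3 h4 h5
    rw [h1, h5, Pi.add_apply, h2, h3, h4, Pi.add_apply, map_add]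
  map_smul' c G := by
    refine Lp.ext ?_
    filter_upwards [(memLp_flux hlam hLam hΛ (c • G)).coeFn_toLp,
      (memLp_flux hlam hLam hΛ G).coeFn_toLp, Lp.coeFn_smul c G,
      Lp.coeFn_smul c ((memLp_flux hlam hLam hΛ G).toLp _)] with x h1 h2 h3 h4
    rw [h1, RingHom.id_apply, h4, Pi.smul_apply, h2, h3, Pi.smul_apply, map_smul]

variable (hlam : 0 < lam) (hLam : 0 < Lam) (hΛ : IsDiffusionTensor Ω Λ lam Lam)

lemma coeFn_fluxMap (G : L2Vec Ω) : fluxMap hlam hLam hΛ G =ᵐ[volume.restrict Ω]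
    fun x => Matrix.toEuclideanLin (Λ x) (G x) := (memLp_flux hlam hLam hΛ G).coeFn_toLp

lemma energy_eq_inner (G H : L2Vec Ω) : energy Ω Λ G H = ⟪fluxMap hlam hLam hΛ G, H⟫ := by
  rw [L2.inner_def, energy]
  refine integral_congr_ae ?_
  filter_upwards [coeFn_fluxMap hlam hLam hΛ G] with x hx
  rw [hx]

lemma inner_fluxMap_comm (G H : L2Vec Ω) :
    ⟪fluxMap hlam hLam hΛ G, H⟫ = ⟪fluxMap hlam hLam hΛ H, G⟫ := by
  rw [← energy_eq_inner, ← energy_eq_inner, energy, energy]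
  refine integral_congr_ae ?_
  filter_upwards [hΛ.2] with x hx
  rw [inner_toEuclideanLin_comm hx.1, real_inner_comm]

lemma mul_norm_sq_le_inner_fluxMap (G : L2Vec Ω) :
    lam * ‖G‖ ^ 2 ≤ ⟪fluxMap hlam hLam hΛ G, G⟫ := by
  rw [← real_inner_self_eq_norm_sq, L2.inner_def, L2.inner_def, ← integral_const_mul]
  refine integral_mono_ae ((L2.integrable_inner G G).const_mul lam)
    (L2.integrable_inner (fluxMap hlam hLam hΛ G) G) ?_
  filter_upwards [coeFn_fluxMap hlam hLam hΛ G, hΛ.2] with x h1 h2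
  rw [h1, real_inner_self_eq_norm_sq]
  exact mul_norm_sq_le_inner_toEuclideanLin h2.1 h2.2 _

lemma norm_fluxMap_le (G : L2Vec Ω) : ‖fluxMap hlam hLam hΛ G‖ ≤ Lam * ‖G‖ := by
  refine Lp.norm_le_mul_norm_of_ae_le_mul ?_
  filter_upwards [coeFn_fluxMap hlam hLam hΛ G, hΛ.2] with x h1 h2
  rw [h1]
  exact norm_toEuclideanLin_le hlam hLam h2.1 h2.2 _

end Diffusion

/-! ### Constraints, traces and the error estimate. -/

section ErrorEstimate

variable {d : ℕ} {Ω : Set (E d)}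

section Traces

/-- A convergent sequence in L² has a subsequence converging almost everywhere, along which the
pointwise inequality passes to the limit. -/
lemma isClosed_setOf_ae_le_on {α : Type*} [MeasurableSpace α] {μ : Measure α} (Γ : Set α)
    (a : Lp ℝ 2 μ) : IsClosed {g : Lp ℝ 2 μ | ∀ᵐ x ∂μ, x ∈ Γ → g x ≤ a x} := by
  refine IsSeqClosed.isClosed fun u g hu hg => ?_
  obtain ⟨ns, -, hns⟩ := (tendstoInMeasure_of_tendsto_Lp hg).exists_seq_tendsto_ae
  filter_upwards [hns, ae_all_iff.2 hu] with x hx hux hxΓ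
  exact le_of_tendsto hx (Eventually.of_forall fun n => hux (ns n) hxΓ)

lemma convex_setOf_ae_le_on {α : Type*} [MeasurableSpace α] {μ : Measure α} (Γ : Set α)
    (a : Lp ℝ 2 μ) : Convex ℝ {g : Lp ℝ 2 μ | ∀ᵐ x ∂μ, x ∈ Γ → g x ≤ a x} := by
  intro g hg h hh s t hs ht hst
  filter_upwards [hg, hh, Lp.coeFn_add (s • g) (t • h), Lp.coeFn_smul s g, Lp.coeFn_smul t h]
    with x h1 h2 h3 h4 h5 hx
  rw [h3, Pi.add_apply, h4, h5, Pi.smul_apply, Pi.smul_apply, smul_eq_mul, smul_eq_mul]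
  calc s * g x + t * h x ≤ s * a x + t * a x := by
        gcongr
        exacts [h1 hx, h2 hx]
    _ = a x := by rw [← add_mul, hst, one_mul]

lemma hHalfNorm_nonneg (g : HHalf Ω) : 0 ≤ hHalfNorm g := by
  refine Real.sInf_nonneg ?_
  rintro r ⟨w, -, rfl⟩
  exact norm_nonneg w

lemma hHalfNorm_le {g : HHalf Ω} {w : H1 Ω} (hw : IsTrace Ω w g) : hHalfNorm g ≤ ‖w‖ := by
  refine csInf_le ⟨0, ?_⟩ ⟨w, hw, rfl⟩
  rintro r ⟨w, -, rfl⟩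
  exact norm_nonneg w

/-- A test function has zero trace. -/
lemma isTrace_testFunction (hΩ : IsOpen Ω) {φ : E d → ℝ} (hφ : IsTestFunction Ω φ) :
    IsTrace Ω (smoothH1 Ω hφ.1 hφ.2.1) 0 := by
  refine Submodule.le_topologicalClosure _ ⟨φ, hφ.1, hφ.2.1, fn_smoothH1 hφ.1 hφ.2.1, ?_⟩
  refine (Lp.coeFn_zero ℝ 2 (surfaceMeasure Ω)).trans ?_
  refine ae_restrict_of_forall_mem isClosed_frontier.measurableSet fun x hx => ?_
  have : x ∉ tsupport φ := fun h => by
    rw [hΩ.frontier_eq] at hx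
    exact hx.2 (hφ.2.2 h)
  exact (image_eq_zero_of_notMem_tsupport this).symm

variable {X : Type*} [AddCommGroup X] [Module ℝ X] [FiniteDimensional ℝ X]

/-- Linear families of traces have linear liftings. -/
lemma exists_linear_lift (T : X →ₗ[ℝ] HHalf Ω) :
    ∃ R : X →ₗ[ℝ] H1 Ω, ∀ v, IsTrace Ω (R v) (T v) := by
  choose w hw using exists_isTrace (Ω := Ω)
  let b := Module.finBasis ℝ X
  let R : X →ₗ[ℝ] H1 Ω := b.constr ℝ fun i => w (T (b i))
  let P : X →ₗ[ℝ] H1 Ω × L2Bd Ω := R.prod ((HHalf Ω).subtype ∘ₗ T)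
  -- Traces form a linear relation, so it is enough to check the lifting on the basis where it was
  -- chosen.
  have htop : (⊤ : Submodule ℝ X) ≤ (traceGraph Ω).comap P := by
    rw [← b.span_eq, Submodule.span_le]
    rintro _ ⟨i, rfl⟩
    have h1 : R (b i) = w (T (b i)) := b.constr_basis ℝ _ i
    have h2 : IsTrace Ω (R (b i)) (T (b i)) := by
      rw [h1]
      exact hw _
    exact h2
  exact ⟨R, fun v => htop (Submodule.mem_top (x := v))⟩

end Traces

namespace GradientDiscretisation

variable {Γ₁ : Set (E d)} {X : Type*} [AddCommGroup X] [Module ℝ X]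
  [FiniteDimensional ℝ X] (D : GradientDiscretisation Ω Γ₁ X)

/-- The reconstructed trace as a linear map into `H^{1/2}(∂Ω)`. -/
def trL : X →ₗ[ℝ] HHalf Ω := (HHalfZero Ω Γ₁).subtype ∘ₗ D.recTrace

lemma norm_recGrad_pos {v : X} (hv : v ≠ 0) : 0 < ‖D.recGrad v‖ :=
  lt_of_le_of_ne (norm_nonneg _) fun h => hv (D.recGrad_norm v h.symm)

lemma coercivity_nonneg : 0 ≤ D.coercivity := by
  refine Real.sSup_nonneg ?_
  rintro r ⟨v, -, rfl⟩
  have := hHalfNorm_nonneg (D.tr v)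
  positivity

/-- A linear lifting `R` of the traces bounds `hHalfNorm` by `‖R v‖`, which finite dimension
controls. Boundedness matters because a real `sSup` of an unbounded set is 0. -/
lemma bddAbove_coercivity : BddAbove {r | ∃ v : X, v ≠ 0 ∧
    r = ‖D.recFn v‖ / ‖D.recGrad v‖ + hHalfNorm (D.tr v) / ‖D.recGrad v‖} := by
  obtain ⟨C, -, hC⟩ := exists_norm_le_of_finiteDimensional D.recGrad D.recGrad_norm D.recFn
  obtain ⟨R, hR⟩ := exists_linear_lift D.trL
  obtain ⟨C', -, hC'⟩ := exists_norm_le_of_finiteDimensional D.recGrad D.recGrad_norm R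
  refine ⟨C + C', ?_⟩
  rintro r ⟨v, hv, rfl⟩
  have hpos := D.norm_recGrad_pos hv
  refine add_le_add ((div_le_iff₀ hpos).2 (hC v)) ((div_le_iff₀ hpos).2 ?_)
  exact (hHalfNorm_le (hR v)).trans (hC' v)

lemma norm_recFn_le (v : X) : ‖D.recFn v‖ ≤ D.coercivity * ‖D.recGrad v‖ := by
  rcases eq_or_ne v 0 with rfl | hv
  · simp
  have hpos := D.norm_recGrad_pos hv
  rw [← div_le_iff₀ hpos]
  have h1 := le_csSup D.bddAbove_coercivity ⟨v, hv, rfl⟩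
  have h2 : 0 ≤ hHalfNorm (D.tr v) / ‖D.recGrad v‖ :=
    div_nonneg (hHalfNorm_nonneg _) (norm_nonneg _)
  exact (le_add_of_nonneg_right h2).trans h1

lemma integral_conformity_eq (ψ : Hdiv Ω) (v : X) :
    ∫ x in Ω, (⟪D.recGrad v x, ψ.field x⟫ + D.recFn v x * ψ.div x)
      = ⟪D.recGrad v, ψ.field⟫ + ⟪D.recFn v, ψ.div⟫ := by
  rw [← integral_mul_eq_inner, L2.inner_def]
  exact integral_add (L2.integrable_inner (D.recGrad v) ψ.field)
    ((Lp.memLp (D.recFn v)).integrable_mul (Lp.memLp ψ.div))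

lemma limitConformity_nonneg (ψ : Hdiv Ω) : 0 ≤ D.limitConformity ψ := by
  refine Real.sSup_nonneg ?_
  rintro r ⟨v, -, rfl⟩
  positivity

/-- Only linearity of `normalTrace ψ` is used, so its default value 0 causes no trouble here. -/
lemma bddAbove_limitConformity (ψ : Hdiv Ω) : BddAbove {r | ∃ v : X, v ≠ 0 ∧
    r = 1 / ‖D.recGrad v‖ *
      |(∫ x in Ω, (⟪D.recGrad v x, ψ.field x⟫ + D.recFn v x * ψ.div x))
        - normalTrace ψ (D.tr v)|} := by
  obtain ⟨C, -, hC⟩ := exists_norm_le_of_finiteDimensional D.recGrad D.recGrad_norm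
    (normalTrace ψ ∘ₗ D.trL)
  refine ⟨‖ψ.field‖ + D.coercivity * ‖ψ.div‖ + C, ?_⟩
  rintro r ⟨v, hv, rfl⟩
  have hpos := D.norm_recGrad_pos hv
  rw [one_div_mul_eq_div, div_le_iff₀ hpos, integral_conformity_eq]
  have h1 := abs_real_inner_le_norm (D.recGrad v) ψ.field
  have h2 := abs_real_inner_le_norm (D.recFn v) ψ.div
  have h3 : |normalTrace ψ (D.tr v)| ≤ C * ‖D.recGrad v‖ := hC v
  have h4 : ‖D.recFn v‖ * ‖ψ.div‖ ≤ D.coercivity * ‖D.recGrad v‖ * ‖ψ.div‖ := by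
    gcongr
    exact D.norm_recFn_le v
  calc _ ≤ |⟪D.recGrad v, ψ.field⟫| + |⟪D.recFn v, ψ.div⟫| + |normalTrace ψ (D.tr v)| :=
        (abs_sub _ _).trans (add_le_add (abs_add_le _ _) le_rfl)
    _ ≤ _ := by linarith

lemma conformity_le (ψ : Hdiv Ω) (v : X) :
    ⟪D.recGrad v, ψ.field⟫ + ⟪D.recFn v, ψ.div⟫ - normalTrace ψ (D.trL v)
      ≤ D.limitConformity ψ * ‖D.recGrad v‖ := by
  rcases eq_or_ne v 0 with rfl | hv
  · simp
  have hpos := D.norm_recGrad_pos hv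
  refine (le_abs_self _).trans ?_
  rw [← div_le_iff₀ hpos, ← one_div_mul_eq_div, ← integral_conformity_eq]
  exact le_csSup (D.bddAbove_limitConformity ψ) ⟨v, hv, rfl⟩

variable {Γ₃ : Set (E d)} {Λ : E d → Matrix (Fin d) (Fin d) ℝ} {lam Lam : ℝ}

/-- The gradient scheme is well posed. -/
lemma existsUnique_isSolution (hlam : 0 < lam) (hLam : 0 < Lam)
    (hΛ : IsDiffusionTensor Ω Λ lam Lam) (f : L2 Ω) (a : L2Bd Ω)
    (hK : (D.admissibleSet Γ₃ a).Nonempty) : ∃! u : X, D.IsSolution Γ₃ Λ f a u := by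
  let B : X →ₗ[ℝ] X →ₗ[ℝ] ℝ :=
    ((innerₗ (L2Vec Ω)).compl₁₂ (fluxMap hlam hLam hΛ ∘ₗ D.recGrad) D.recGrad)
  have hB : ∀ u v, B u v = ⟪fluxMap hlam hLam hΛ (D.recGrad u), D.recGrad v⟫ := fun _ _ => rfl
  let L : X →ₗ[ℝ] ℝ := innerₗ (L2 Ω) f ∘ₗ D.recFn
  have hL : ∀ v, L v = ∫ x in Ω, f x * D.recFn v x := fun v => by
    rw [integral_mul_eq_inner]; rfl
  have h := existsUnique_variationalInequality B
    (fun u v => by rw [hB, hB, inner_fluxMap_comm])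
    (fun v hv => by
      rw [hB]
      have := D.norm_recGrad_pos hv
      exact lt_of_lt_of_le (by positivity) (mul_norm_sq_le_inner_fluxMap hlam hLam hΛ _))
    ((HHalf Ω).subtype ∘ₗ D.trL) (isClosed_setOf_ae_le_on Γ₃ a) (convex_setOf_ae_le_on Γ₃ a) hK L
  have hiff : ∀ u, D.IsSolution Γ₃ Λ f a u ↔
      ((HHalf Ω).subtype ∘ₗ D.trL) u ∈ {g : L2Bd Ω | ∀ᵐ x ∂(surfaceMeasure Ω), x ∈ Γ₃ → g x ≤ a x} ∧
      ∀ v, ((HHalf Ω).subtype ∘ₗ D.trL) v ∈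
        {g : L2Bd Ω | ∀ᵐ x ∂(surfaceMeasure Ω), x ∈ Γ₃ → g x ≤ a x} →
        B u (u - v) ≤ L (u - v) := by
    intro u
    simp only [hB, hL, ← energy_eq_inner hlam hLam hΛ]
    exact Iff.rfl
  simpa only [hiff] using h

end GradientDiscretisation

/-- The flux of the exact solution is in `H_div(Ω)`, with divergence `-f`. -/
lemma IsSignoriniSolution.isWeakDivergence {Γ₁ Γ₃ : Set (E d)}
    {Λ : E d → Matrix (Fin d) (Fin d) ℝ} {lam Lam : ℝ} (hlam : 0 < lam) (hLam : 0 < Lam)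
    (hΛ : IsDiffusionTensor Ω Λ lam Lam) (hΩ : IsOpen Ω) {f : L2 Ω} {a : L2Bd Ω} {u : H1 Ω}
    (hu : IsSignoriniSolution Ω Γ₁ Γ₃ Λ f a u) :
    IsWeakDivergence Ω (fluxMap hlam hLam hΛ (H1.grad u)) (-f) := by
  intro φ hφ
  set s := smoothH1 Ω hφ.1 hφ.2.1 with hs
  set A := fluxMap hlam hLam hΛ (H1.grad u) with hA
  -- A test function has zero trace, so subtracting any multiple of it from `u` keeps the
  -- constraints. The two signs of `c` turn the inequality into an equality.
  have hvar : ∀ c : ℝ, c * ⟪A, H1.grad s⟫ ≤ c * ⟪f, H1.fn s⟫ := by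
    intro c
    have hadm : u - c • s ∈ admissibleSet Ω Γ₁ Γ₃ a := by
      refine hu.1.elim fun g hg => ⟨g, ?_, hg.2⟩
      have h := hg.1.sub ((isTrace_testFunction hΩ hφ).smul c)
      rwa [smul_zero, sub_zero] at h
    have h := hu.2 _ hadm
    have e1 : u - (u - c • s) = c • s := sub_sub_cancel _ _
    have e2 : H1.grad (c • s) = c • H1.grad s := map_smul (H1.gradL Ω) c s
    have e3 : H1.fn (c • s) = c • H1.fn s := map_smul (H1.fnL Ω) c s
    rwa [e1, e2, e3, energy_eq_inner hlam hLam hΛ, integral_mul_eq_inner, real_inner_smul_right,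
      real_inner_smul_right] at h
  have h1 := hvar 1
  have h2 := hvar (-1)
  have heq : ⟪A, H1.grad s⟫ = ⟪f, H1.fn s⟫ := by linarith
  have e1 : ∫ x in Ω, ∑ i, A x i * partialDeriv i φ x = ⟪A, H1.grad s⟫ := by
    rw [L2.inner_def]
    refine integral_congr_ae ?_
    filter_upwards [grad_smoothH1 (Ω := Ω) hφ.1 hφ.2.1] with x hx
    rw [hs, hx, inner_gradient]
  have e2 : ∫ x in Ω, (-f : L2 Ω) x * φ x = -⟪f, H1.fn s⟫ := by
    rw [← inner_neg_left, ← integral_mul_eq_inner]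
    refine integral_congr_ae ?_
    filter_upwards [fn_smoothH1 (Ω := Ω) hφ.1 hφ.2.1] with x hx
    rw [hs, hx]
  rw [e1, e2, heq, neg_neg]

/-- The normal flux of the exact solution is nonnegative on admissible variations of the trace. -/
lemma IsSignoriniSolution.normalTrace_sub_nonneg {Γ₁ Γ₃ : Set (E d)}
    {Λ : E d → Matrix (Fin d) (Fin d) ℝ} {lam Lam : ℝ} (hlam : 0 < lam) (hLam : 0 < Lam)
    (hΛ : IsDiffusionTensor Ω Λ lam Lam) {f : L2 Ω} {a : L2Bd Ω} {u : H1 Ω}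
    (hu : IsSignoriniSolution Ω Γ₁ Γ₃ Λ f a u) {ψ : Hdiv Ω}
    (hψ : ψ.field = fluxMap hlam hLam hΛ (H1.grad u)) (hψd : ψ.div = -f)
    (hn : IsNormalTrace ψ (normalTrace ψ)) {γu g : HHalf Ω} (hγ : IsTrace Ω u γu)
    (hg1 : ∀ᵐ x ∂(surfaceMeasure Ω), x ∈ Γ₁ → (g : L2Bd Ω) x = 0)
    (hg3 : ∀ᵐ x ∂(surfaceMeasure Ω), x ∈ Γ₃ → (g : L2Bd Ω) x ≤ a x) :
    0 ≤ normalTrace ψ (g - γu) := by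
  -- Any lifting `w` of `g` is an admissible competitor, and Green's formula rewrites the inequality
  -- tested with `w` as a sign of the normal trace.
  refine (exists_isTrace g).elim fun w hw => ?_
  have h := hu.2 w ⟨g, hw, hg1, hg3⟩
  rw [energy_eq_inner hlam hLam hΛ, integral_mul_eq_inner, ← hψ] at h
  have hpair := hn (w - u) (g - γu) (hw.sub hγ)
  rw [hpair, ← greenPairing_apply, ← neg_sub u w, map_neg]
  have h2 : greenPairing ψ (u - w) = ⟪ψ.field, H1.grad (u - w)⟫ + ⟪ψ.div, H1.fn (u - w)⟫ := rfl
  rw [h2, hψd, inner_neg_left]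
  linarith

/-- If `x > s + b / lam` with `s` the square root, then `lam x² > lam s x + b x ≥ lam s² + b x`,
which contradicts the hypothesis. The factor 2 is not sharp: `lam s² ≥ G` is enough. -/
lemma le_sqrt_add_of_mul_sq_le {lam x b G : ℝ} (hlam : 0 < lam)
    (h : lam * x ^ 2 ≤ b * x + G) (hb : 0 ≤ b) :
    x ≤ √(2 / lam * max 0 G) + 1 / lam * b := by
  set s := √(2 / lam * max 0 G) with hs
  have hs0 : 0 ≤ s := Real.sqrt_nonneg _
  have hG := le_max_left 0 G
  have hG' := le_max_right 0 G
  have hss : lam * s ^ 2 = 2 * max 0 G := by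
    rw [hs, Real.sq_sqrt (by positivity)]
    field_simp
  by_contra! hlt
  have hb' : lam * (1 / lam * b) = b := by field_simp
  have h0 : 0 ≤ 1 / lam * b := by positivity
  have h1 : lam * x * (s + 1 / lam * b) < lam * x * x :=
    mul_lt_mul_of_pos_left hlt (mul_pos hlam (by linarith))
  have h2 : lam * x * (s + 1 / lam * b) = lam * s * x + b * x := by
    linear_combination x * hb'
  have h3 : lam * s * s ≤ lam * s * x := by
    have : s ≤ x := by linarith
    gcongr
  nlinarith

/-- The cut-off is built from the distance to the complement, which must be nonempty. This would
fail for `d = 0`, where the whole space is bounded. -/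
lemma ne_univ_of_isBounded (hd : 1 ≤ d) (hΩb : Bornology.IsBounded Ω) : Ω ≠ univ := by
  rintro rfl
  have : Nonempty (Fin d) := ⟨⟨0, hd⟩⟩
  exact NormedSpace.unbounded_univ ℝ (E d) hΩb

/-- The error estimate on the reconstructed gradient, before the triangle inequality. -/
lemma GradientDiscretisation.norm_recGrad_sub_le {Γ₁ Γ₃ : Set (E d)} {X : Type*}
    [AddCommGroup X] [Module ℝ X] [FiniteDimensional ℝ X] (D : GradientDiscretisation Ω Γ₁ X)
    {Λ : E d → Matrix (Fin d) (Fin d) ℝ} {lam Lam : ℝ} (hlam : 0 < lam) (hLam : 0 < Lam)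
    (hΛ : IsDiffusionTensor Ω Λ lam Lam) {f : L2 Ω} {a : L2Bd Ω} {ubar : H1 Ω}
    (hubar : IsSignoriniSolution Ω Γ₁ Γ₃ Λ f a ubar) {ψ : Hdiv Ω}
    (hψ : ψ.field = fluxMap hlam hLam hΛ (H1.grad ubar)) (hψd : ψ.div = -f)
    (hn : IsNormalTrace ψ (normalTrace ψ)) {u v : X} (hu : D.IsSolution Γ₃ Λ f a u)
    {γu : HHalf Ω} (hγ : IsTrace Ω ubar γu) (hv : v ∈ D.admissibleSet Γ₃ a) :
    ‖D.recGrad (v - u)‖ ≤ √(2 / lam * max 0 (normalTrace ψ (D.tr v - γu)))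
      + 1 / lam * (D.limitConformity ψ + Lam * D.consistency ubar v) := by
  -- The discrete solution itself provides an admissible trace: it vanishes on Γ₁ by the codomain of
  -- `recTrace` and satisfies the barrier because `u` solves the scheme.
  have htr := hubar.normalTrace_sub_nonneg hlam hLam hΛ hψ hψd hn hγ (D.recTrace u).2 hu.1
  change 0 ≤ normalTrace ψ (D.trL u - γu) at htr
  change _ ≤ √(2 / lam * max 0 (normalTrace ψ (D.trL v - γu))) + _
  have hconf := D.conformity_le ψ (v - u)
  have hsol := hu.2 v hv
  have hS : ‖D.recGrad v - H1.grad ubar‖ ≤ D.consistency ubar v :=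
    le_add_of_nonneg_left (norm_nonneg _)
  have hS0 : 0 ≤ D.consistency ubar v := (norm_nonneg _).trans hS
  have hcoer := mul_norm_sq_le_inner_fluxMap hlam hLam hΛ (D.recGrad (v - u))
  have hup : ⟪fluxMap hlam hLam hΛ (D.recGrad v - H1.grad ubar), D.recGrad (v - u)⟫
      ≤ Lam * D.consistency ubar v * ‖D.recGrad (v - u)‖ := by
    refine (real_inner_le_norm _ _).trans ?_
    gcongr
    exact (norm_fluxMap_le hlam hLam hΛ _).trans (by gcongr)
  rw [energy_eq_inner hlam hLam hΛ, integral_mul_eq_inner, ← neg_sub v u, map_neg, map_neg,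
    inner_neg_right, inner_neg_right] at hsol
  rw [hψ, hψd, inner_neg_right, map_sub D.trL, map_sub (normalTrace ψ), real_inner_comm,
    real_inner_comm f] at hconf
  rw [map_sub (normalTrace ψ)] at htr
  -- Inserting `∇ubar` separates the consistency error from the residual `Λ(∇ubar - ∇_D u)`. The
  -- scheme, `hconf` and `htr` bound that residual by `W_D x + G_D`.
  have hexp : ⟪fluxMap hlam hLam hΛ (D.recGrad (v - u)), D.recGrad (v - u)⟫
      = ⟪fluxMap hlam hLam hΛ (D.recGrad v - H1.grad ubar), D.recGrad (v - u)⟫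
        + ⟪fluxMap hlam hLam hΛ (H1.grad ubar), D.recGrad (v - u)⟫
        - ⟪fluxMap hlam hLam hΛ (D.recGrad u), D.recGrad (v - u)⟫ := by
    rw [← inner_add_left, ← inner_sub_left, ← map_add, ← map_sub, sub_add_cancel,
      ← map_sub D.recGrad]
  refine le_sqrt_add_of_mul_sq_le hlam ?_
    (add_nonneg (D.limitConformity_nonneg ψ) (mul_nonneg hLam.le hS0))
  rw [map_sub (normalTrace ψ)]
  linarith

end ErrorEstimate

end Signorini

end

theorem theorem2p1 {d : ℕ} (hd : 1 ≤ d)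
    -- the domain
    (Ω : Set (Signorini.E d)) (hΩo : IsOpen Ω) (hΩb : Bornology.IsBounded Ω)
    (hΩc : IsConnected Ω) (hΩL : Signorini.HasLipschitzBoundary Ω)
    -- the diffusion tensor, with `0 < lam` and `0 < Lam`
    (Λ : Signorini.E d → Matrix (Fin d) (Fin d) ℝ) (lam Lam : ℝ) (hlam : 0 < lam) (hLam : 0 < Lam)
    (hΛ : Signorini.IsDiffusionTensor Ω Λ lam Lam)
    -- the partition of the boundary
    (Γ₁ Γ₂ Γ₃ : Set (Signorini.E d))
    (hΓ₁m : NullMeasurableSet Γ₁ (Signorini.surfaceMeasure Ω))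
    (hΓ₂m : NullMeasurableSet Γ₂ (Signorini.surfaceMeasure Ω))
    (hΓ₃m : NullMeasurableSet Γ₃ (Signorini.surfaceMeasure Ω))
    (hΓ₁₂ : Disjoint Γ₁ Γ₂) (hΓ₁₃ : Disjoint Γ₁ Γ₃) (hΓ₂₃ : Disjoint Γ₂ Γ₃)
    (hΓ : Γ₁ ∪ Γ₂ ∪ Γ₃ = frontier Ω)
    (hΓ₁ : 0 < Signorini.surfaceMeasure Ω Γ₁)
    -- the source term, the barrier and the exact solution
    (f : Signorini.L2 Ω) (a : Signorini.L2Bd Ω)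
    (ubar : Signorini.H1 Ω) (hubar : Signorini.IsSignoriniSolution Ω Γ₁ Γ₃ Λ f a ubar)
    -- the gradient discretisation
    {X : Type*} [AddCommGroup X] [Module ℝ X] [FiniteDimensional ℝ X]
    (D : Signorini.GradientDiscretisation Ω Γ₁ X) (hK : (D.admissibleSet Γ₃ a).Nonempty) :
    (∃! u : X, D.IsSolution Γ₃ Λ f a u) ∧
    -- the flux `ψ = Λ ∇ubar` belongs to `H_div(Ω)` and has a normal trace
    ∃ ψ : Signorini.Hdiv Ω,
      (ψ.field =ᵐ[volume.restrict Ω] fun x => Matrix.toEuclideanLin (Λ x) (Signorini.H1.grad ubar x)) ∧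
      Signorini.IsNormalTrace ψ (Signorini.normalTrace ψ) ∧
      ∀ u : X, D.IsSolution Γ₃ Λ f a u →
      ∀ γubar : Signorini.HHalf Ω, Signorini.IsTrace Ω ubar γubar →
      ∀ v ∈ D.admissibleSet Γ₃ a,
        ‖D.recGrad u - Signorini.H1.grad ubar‖ ≤
            √(2 / lam * max 0 (Signorini.normalTrace ψ (D.tr v - γubar)))
            + 1 / lam * (D.limitConformity ψ + (Lam + lam) * D.consistency ubar v) ∧
        ‖D.recFn u - Signorini.H1.fn ubar‖ ≤
            D.coercivity * √(2 / lam * max 0 (Signorini.normalTrace ψ (D.tr v - γubar)))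
            + 1 / lam * (D.coercivity * D.limitConformity ψ
              + (D.coercivity * Lam + lam) * D.consistency ubar v) := by
  have hΩu := Signorini.ne_univ_of_isBounded hd hΩb
  refine ⟨D.existsUnique_isSolution hlam hLam hΛ f a hK, ?_⟩
  let ψ : Signorini.Hdiv Ω :=
    ⟨Signorini.fluxMap hlam hLam hΛ (Signorini.H1.grad ubar), -f,
      hubar.isWeakDivergence hlam hLam hΛ hΩo⟩
  have hn : Signorini.IsNormalTrace ψ (Signorini.normalTrace ψ) :=
    Signorini.isNormalTrace_normalTrace hd hΩo hΩb hΩu hΩL ψ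
  refine ⟨ψ, Signorini.coeFn_fluxMap hlam hLam hΛ _, hn, fun u hu γubar hγ v hv => ?_⟩
  have hx := D.norm_recGrad_sub_le hlam hLam hΛ hubar (ψ := ψ) rfl rfl hn hu hγ hv
  have hC := D.coercivity_nonneg
  have hrec := D.norm_recFn_le (v - u)
  have hCx := mul_le_mul_of_nonneg_left hx hC
  -- The triangle inequality adds one more `S_D`; written as `(1/lam) · lam S_D`, it accounts for
  -- the summand `lam` in both coefficients.
  have hlS : 1 / lam * (lam * D.consistency ubar v) = D.consistency ubar v := by field_simp
  have hS : D.consistency ubar v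
      = ‖D.recFn v - Signorini.H1.fn ubar‖ + ‖D.recGrad v - Signorini.H1.grad ubar‖ := rfl
  have h1 : ‖D.recGrad u - Signorini.H1.grad ubar‖
      ≤ ‖D.recGrad (v - u)‖ + ‖D.recGrad v - Signorini.H1.grad ubar‖ := by
    rw [map_sub, norm_sub_rev (D.recGrad v) (D.recGrad u)]
    exact norm_sub_le_norm_sub_add_norm_sub _ _ _
  have h2 : ‖D.recFn u - Signorini.H1.fn ubar‖
      ≤ ‖D.recFn (v - u)‖ + ‖D.recFn v - Signorini.H1.fn ubar‖ := by
    rw [map_sub, norm_sub_rev (D.recFn v) (D.recFn u)]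
    exact norm_sub_le_norm_sub_add_norm_sub _ _ _
  have h3 := norm_nonneg (D.recFn v - Signorini.H1.fn ubar)
  have h4 := norm_nonneg (D.recGrad v - Signorini.H1.grad ubar)
  constructor
  · refine h1.trans ?_
    linarith
  · refine h2.trans ?_
    linarith
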